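/- Let $b_\pm,\delta_\pm,c$ be real numbers with $b_\pm>0$, $b_\pm+\delta_\pm>0$ and $c>0$. For $n\in\mathbb Z$ put $b_n=b_+$ and $d_n=b_++\delta_+$ if $n\ge 0$; $b_n=b_-$ and $d_n=b_-+\delta_-$ if $n\le -1$; and $c_n=b_++\delta_+$ if $n\ge 0$, $c_{-1}=c$, $c_n=b_-+\delta_-$ if $n\le -2$. For $k\in\mathbb R$ let $\widehat H_{\mathrm I}(k)$ be the bounded operator on $\ell^2(\mathbb Z;\mathbb C^6)$ which maps $\mathbf u=(u_{j,n})_{1\le j\le 6,\,n\in\mathbb Z}$ to \begin{align*} (\widehat H_{\mathrm I}(k)\mathbf u)_{1,n}&=-b_nu_{4,n}-b_nu_{5,n}-c_{n-1}e^{-ik}u_{6,n-1},\\ (\widehat H_{\mathrm I}(k)\mathbf u)_{2,n}&=-b_nu_{4,n}-d_ne^{ik}u_{5,n}-b_nu_{6,n},\\ (\widehat H_{\mathrm I}(k)\mathbf u)_{3,n}&=-c_nu_{4,n+1}-b_nu_{5,n}-b_nu_{6,n},\\ (\widehat H_{\mathrm I}(k)\mathbf u)_{4,n}&=-b_nu_{1,n}-b_nu_{2,n}-c_{n-1}u_{3,n-1},\\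 (\widehat H_{\mathrm I}(k)\mathbf u)_{5,n}&=-b_nu_{1,n}-d_ne^{-ik}u_{2,n}-b_nu_{3,n},\\ (\widehat H_{\mathrm I}(k)\mathbf u)_{6,n}&=-c_ne^{ik}u_{1,n+1}-b_nu_{2,n}-b_nu_{3,n}. \end{align*} Suppose that $0$ is a two-fold eigenvalue of $\widehat H_{\mathrm I}(0)$, that is, $\dim\ker\widehat H_{\mathrm I}(0)=2$. Then there are a constant $E^{(1)}_{\mathrm I}>0$ and real functions $E_{\mathrm I,-}(k),E_{\mathrm I,+}(k)$ such that, for some $\eta>0$ and all sufficiently small $|k|$, the eigenvalues $E$ of $\widehat H_{\mathrm I}(k)$ with $|E|<\eta$ are exactly $E_{\mathrm I,-}(k)$ and $E_{\mathrm I,+}(k)$, these satisfy $E_{\mathrm I,-}(k)<E_{\mathrm I,+}(k)$ if $k\ne0$, and \[ E_{\mathrm I,\pm}(k)=\pm E^{(1)}_{\mathrm I}|k|+\mathcal O(k^2)\qquad(k\to0). \] Consequently $E_{\mathrm I,\pm}(0)=0$ and the energy curves cross non-tangentially at $k=0$: the curve equal to $E_{\mathrm I,+}$ for $k\ge0$ and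 to $E_{\mathrm I,-}$ for $k<0$ has derivative $E^{(1)}_{\mathrm I}$ at $0$, and the curve equal to $E_{\mathrm I,-}$ for $k\ge0$ and to $E_{\mathrm I,+}$ for $k<0$ has derivative $-E^{(1)}_{\mathrm I}$ at $0$. -/

import Mathlib

open Asymptotics Filter Topology
open scoped ENNReal

noncomputable section

/-- The real parameters `(b₊, b₋, δ₊, δ₋, c)` of two half-plane materials joined along an interface:
intracell hopping `b±`, intercell hopping `b± + δ±`, and hopping `c` across the interface. -/
structure HoppingParameters where
  bPlus : ℝ
  bMinus : ℝ
  deltaPlus : ℝ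
  deltaMinus : ℝ
  c : ℝ

namespace HoppingParameters

/-- All hopping coefficients are strictly positive. -/
structure Positive (p : HoppingParameters) : Prop where
  bPlus_pos : 0 < p.bPlus
  bMinus_pos : 0 < p.bMinus
  interPlus_pos : 0 < p.bPlus + p.deltaPlus
  interMinus_pos : 0 < p.bMinus + p.deltaMinus
  c_pos : 0 < p.c

/-- `a_{n,I}`. -/
def aI (p : HoppingParameters) (n : ℤ) : ℝ :=
  if 1 ≤ n then p.bPlus + p.deltaPlus else if n = 0 then p.c else p.bMinus + p.deltaMinus

/-- `b_{n,I}`. -/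
def bI (p : HoppingParameters) (n : ℤ) : ℝ := if 0 ≤ n then p.bPlus else p.bMinus

/-- `c_{n,I}`. -/
def cI (p : HoppingParameters) (n : ℤ) : ℝ := p.aI (n + 1)

/-- `d_{n,I}`. -/
def dI (p : HoppingParameters) (n : ℤ) : ℝ :=
  if 0 ≤ n then p.bPlus + p.deltaPlus else p.bMinus + p.deltaMinus

/-- A common bound for all the hopping coefficients. -/
def bound (p : HoppingParameters) : ℝ :=
  |p.bPlus| + |p.bMinus| + |p.bPlus + p.deltaPlus| + |p.bMinus + p.deltaMinus| + |p.c|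

theorem abs_aI_le (p : HoppingParameters) (n : ℤ) : |p.aI n| ≤ p.bound := by
  unfold aI bound
  have h1 := abs_nonneg p.bPlus
  have h2 := abs_nonneg p.bMinus
  have h3 := abs_nonneg (p.bPlus + p.deltaPlus)
  have h4 := abs_nonneg (p.bMinus + p.deltaMinus)
  have h5 := abs_nonneg p.c
  split_ifs <;> linarith

theorem abs_bI_le (p : HoppingParameters) (n : ℤ) : |p.bI n| ≤ p.bound := by
  unfold bI bound
  have h1 := abs_nonneg p.bPlus
  have h2 := abs_nonneg p.bMinus
  have h3 := abs_nonneg (p.bPlus + p.deltaPlus)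
  have h4 := abs_nonneg (p.bMinus + p.deltaMinus)
  have h5 := abs_nonneg p.c
  split_ifs <;> linarith

theorem abs_dI_le (p : HoppingParameters) (n : ℤ) : |p.dI n| ≤ p.bound := by
  unfold dI bound
  have h1 := abs_nonneg p.bPlus
  have h2 := abs_nonneg p.bMinus
  have h3 := abs_nonneg (p.bPlus + p.deltaPlus)
  have h4 := abs_nonneg (p.bMinus + p.deltaMinus)
  have h5 := abs_nonneg p.c
  split_ifs <;> linarith

theorem bound_nonneg (p : HoppingParameters) : 0 ≤ p.bound := by
  unfold bound
  positivity

end HoppingParameters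

/-- `ℓ²(ℤ; ℂ⁶)`. -/
abbrev EdgeSpace : Type := lp (fun _ : ℤ => EuclideanSpace ℂ (Fin 6)) 2

/-- The factor `e^{ik}`. -/
def phase (k : ℝ) : ℂ := Complex.exp (Complex.I * k)

theorem norm_phase (k : ℝ) : ‖phase k‖ = 1 := by
  rw [phase, mul_comm]
  exact Complex.norm_exp_ofReal_mul_I k

/-- The difference expression of the type-I edge Hamiltonian at quasi-momentum `k`. The coordinates
`0, …, 5` stand for the sites `1, …, 6` of the cell. -/
def hamActionI (p : HoppingParameters) (k : ℝ) (u : ℤ → EuclideanSpace ℂ (Fin 6)) (n : ℤ) :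
    EuclideanSpace ℂ (Fin 6) :=
  !₂[-(p.bI n : ℂ) * u n 3 - (p.bI n : ℂ) * u n 4 - (p.cI (n - 1) : ℂ) * phase (-k) * u (n - 1) 5,
     -(p.bI n : ℂ) * u n 3 - (p.dI n : ℂ) * phase k * u n 4 - (p.bI n : ℂ) * u n 5,
     -(p.cI n : ℂ) * u (n + 1) 3 - (p.bI n : ℂ) * u n 4 - (p.bI n : ℂ) * u n 5,
     -(p.bI n : ℂ) * u n 0 - (p.bI n : ℂ) * u n 1 - (p.cI (n - 1) : ℂ) * u (n - 1) 2,
     -(p.bI n : ℂ) * u n 0 - (p.dI n : ℂ) * phase (-k) * u n 1 - (p.bI n : ℂ) * u n 2,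
     -((p.cI n : ℂ) * phase k) * u (n + 1) 0 - (p.bI n : ℂ) * u n 1 - (p.bI n : ℂ) * u n 2]

theorem norm_three_terms_le {M S : ℝ} {x y z a b c : ℂ} {A B C : ℝ} (hx : ‖x‖ ≤ M) (hy : ‖y‖ ≤ M)
    (hz : ‖z‖ ≤ M) (ha : ‖a‖ ≤ A) (hb : ‖b‖ ≤ B) (hc : ‖c‖ ≤ C) (hS : A + B + C ≤ S) :
    ‖-x * a - y * b - z * c‖ ^ 2 ≤ (M * S) ^ 2 := by
  have hM : 0 ≤ M := (norm_nonneg x).trans hx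
  have h1 : ‖-x * a - y * b - z * c‖ ≤ M * A + M * B + M * C := by
    refine (norm_sub_le _ _).trans (add_le_add ((norm_sub_le _ _).trans (add_le_add ?_ ?_)) ?_)
    · rw [norm_mul, norm_neg]; exact mul_le_mul hx ha (norm_nonneg _) hM
    · rw [norm_mul]; exact mul_le_mul hy hb (norm_nonneg _) hM
    · rw [norm_mul]; exact mul_le_mul hz hc (norm_nonneg _) hM
  have h2 : M * A + M * B + M * C ≤ M * S := by nlinarith
  exact pow_le_pow_left₀ (norm_nonneg _) (h1.trans h2) 2

theorem norm_hamActionI_sq_le (p : HoppingParameters) (k : ℝ)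
    (u : ℤ → EuclideanSpace ℂ (Fin 6)) (n : ℤ) :
    ‖hamActionI p k u n‖ ^ 2 ≤
      162 * p.bound ^ 2 * (‖u (n - 1)‖ ^ 2 + ‖u n‖ ^ 2 + ‖u (n + 1)‖ ^ 2) := by
  set S : ℝ := 3 * (‖u (n - 1)‖ + ‖u n‖ + ‖u (n + 1)‖) with hS
  have e1 := norm_nonneg (u (n - 1))
  have e2 := norm_nonneg (u n)
  have e3 := norm_nonneg (u (n + 1))
  have hb : ‖(p.bI n : ℂ)‖ ≤ p.bound := by simpa using p.abs_bI_le n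
  have hc : ‖(p.cI n : ℂ)‖ ≤ p.bound := by
    rw [Complex.norm_real, Real.norm_eq_abs]
    exact p.abs_aI_le (n + 1)
  have hc' : ‖(p.cI (n - 1) : ℂ)‖ ≤ p.bound := by
    rw [Complex.norm_real, Real.norm_eq_abs]
    exact p.abs_aI_le (n - 1 + 1)
  have hd : ‖(p.dI n : ℂ)‖ ≤ p.bound := by simpa using p.abs_dI_le n
  have hph : ∀ (z : ℂ) (q : ℝ), ‖z‖ ≤ p.bound → ‖z * phase q‖ ≤ p.bound := by
    intro z q hz; rwa [norm_mul, norm_phase, mul_one]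
  have hu : ∀ m j, ‖u m j‖ ≤ ‖u m‖ := fun m j => PiLp.norm_apply_le (u m) j
  have g0 : ‖hamActionI p k u n 0‖ ^ 2 ≤ (p.bound * S) ^ 2 :=
    norm_three_terms_le hb hb (hph _ _ hc') (hu _ _) (hu _ _) (hu _ _) (by linarith)
  have g1 : ‖hamActionI p k u n 1‖ ^ 2 ≤ (p.bound * S) ^ 2 :=
    norm_three_terms_le hb (hph _ _ hd) hb (hu _ _) (hu _ _) (hu _ _) (by linarith)
  have g2 : ‖hamActionI p k u n 2‖ ^ 2 ≤ (p.bound * S) ^ 2 :=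
    norm_three_terms_le hc hb hb (hu _ _) (hu _ _) (hu _ _) (by linarith)
  have g3 : ‖hamActionI p k u n 3‖ ^ 2 ≤ (p.bound * S) ^ 2 :=
    norm_three_terms_le hb hb hc' (hu _ _) (hu _ _) (hu _ _) (by linarith)
  have g4 : ‖hamActionI p k u n 4‖ ^ 2 ≤ (p.bound * S) ^ 2 :=
    norm_three_terms_le hb (hph _ _ hd) hb (hu _ _) (hu _ _) (hu _ _) (by linarith)
  have g5 : ‖hamActionI p k u n 5‖ ^ 2 ≤ (p.bound * S) ^ 2 :=
    norm_three_terms_le (hph _ _ hc) hb hb (hu _ _) (hu _ _) (hu _ _) (by linarith)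
  have key : ‖hamActionI p k u n‖ ^ 2 ≤ 6 * (p.bound * S) ^ 2 := by
    rw [EuclideanSpace.norm_sq_eq, Fin.sum_univ_six]
    linarith
  have hS2 : S ^ 2 ≤ 27 * (‖u (n - 1)‖ ^ 2 + ‖u n‖ ^ 2 + ‖u (n + 1)‖ ^ 2) := by
    rw [hS]
    nlinarith [sq_nonneg (‖u (n - 1)‖ - ‖u n‖), sq_nonneg (‖u (n - 1)‖ - ‖u (n + 1)‖),
      sq_nonneg (‖u n‖ - ‖u (n + 1)‖)]
  have := mul_le_mul_of_nonneg_left hS2 (by positivity : 0 ≤ 6 * p.bound ^ 2)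
  rw [mul_pow] at key
  linarith

theorem hasSum_norm_sq (u : EdgeSpace) : HasSum (fun n : ℤ => ‖u n‖ ^ 2) (‖u‖ ^ 2) := by
  simpa using lp.hasSum_norm (p := 2) (by norm_num) u

theorem hasSum_three_shifts {f : ℤ → ℝ} {a : ℝ} (h : HasSum f a) :
    HasSum (fun n : ℤ => f (n - 1) + f n + f (n + 1)) (3 * a) := by
  have h1 : HasSum (fun n : ℤ => f (n - 1)) a := (Equiv.subRight (1 : ℤ)).hasSum_iff.mpr h
  have h2 : HasSum (fun n : ℤ => f (n + 1)) a := (Equiv.addRight (1 : ℤ)).hasSum_iff.mpr h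
  have h3 := (h1.add h).add h2
  rwa [show a + a + a = 3 * a by ring] at h3

theorem hasSum_norm_sq_shifts (u : EdgeSpace) :
    HasSum (fun n : ℤ => ‖(u : ℤ → EuclideanSpace ℂ (Fin 6)) (n - 1)‖ ^ 2 +
      ‖(u : ℤ → EuclideanSpace ℂ (Fin 6)) n‖ ^ 2 +
      ‖(u : ℤ → EuclideanSpace ℂ (Fin 6)) (n + 1)‖ ^ 2) (3 * ‖u‖ ^ 2) := by
  have h := hasSum_three_shifts (hasSum_norm_sq u)
  exact h

theorem memℓp_hamActionI (p : HoppingParameters) (k : ℝ) (u : EdgeSpace) :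
    Memℓp (hamActionI p k u) 2 := by
  apply memℓp_gen
  have h := (hasSum_norm_sq_shifts u).summable.mul_left (162 * p.bound ^ 2)
  simpa using Summable.of_nonneg_of_le (fun n => sq_nonneg _)
    (fun n => norm_hamActionI_sq_le p k u n) h

/-- The type-I edge Hamiltonian as a linear map. -/
def hamLinI (p : HoppingParameters) (k : ℝ) : EdgeSpace →ₗ[ℂ] EdgeSpace where
  toFun u := ⟨hamActionI p k u, memℓp_hamActionI p k u⟩
  map_add' u v := by
    apply Subtype.ext
    funext n
    change hamActionI p k (⇑(u + v)) n = hamActionI p k u n + hamActionI p k v n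
    ext j
    fin_cases j <;> simp [hamActionI] <;> ring
  map_smul' a u := by
    apply Subtype.ext
    funext n
    change hamActionI p k (⇑(a • u)) n = a • hamActionI p k u n
    ext j
    fin_cases j <;> simp [hamActionI] <;> ring

theorem norm_hamLinI_le (p : HoppingParameters) (k : ℝ) (u : EdgeSpace) :
    ‖hamLinI p k u‖ ≤ 27 * p.bound * ‖u‖ := by
  have h := hasSum_le (fun n => norm_hamActionI_sq_le p k u n) (hasSum_norm_sq (hamLinI p k u))
    ((hasSum_norm_sq_shifts u).mul_left (162 * p.bound ^ 2))
  have hb := p.bound_nonneg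
  refine abs_le_of_sq_le_sq' ?_ (by positivity) |>.2
  nlinarith [mul_nonneg (sq_nonneg p.bound) (sq_nonneg ‖u‖)]

/-- The type-I edge Hamiltonian `Ĥ_I(k)`, a bounded operator on `ℓ²(ℤ; ℂ⁶)`. -/
def hamiltonianI (p : HoppingParameters) (k : ℝ) : EdgeSpace →L[ℂ] EdgeSpace :=
  (hamLinI p k).mkContinuous (27 * p.bound) (norm_hamLinI_le p k)

theorem hamiltonianI_apply (p : HoppingParameters) (k : ℝ) (u : EdgeSpace) (n : ℤ) :
    hamiltonianI p k u n = hamActionI p k u n := rfl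

end

/-! At `k = 0` all phases are `1`, and the Hamiltonian couples the two sublattices through the same
block in both directions. A zero mode can therefore be taken on the first sublattice, and exchanging
the sublattices gives a second one orthogonal to it; since the kernel is two-dimensional, these two
span it. The derivative `H₁` at `k = 0` also couples only opposite sublattices, so compressed to the
kernel it is a Hermitian 2×2 matrix with zero diagonal and off-diagonal entry `a`. First-order
perturbation theory then predicts the energies `± ‖a‖ |k|`.

Two facts about the model make this work. The first is `a ≠ 0` (`inner_swap_deriv_ne_zero`): pairing
the zero-mode equations with the mode itself turns `-2 i a` into a sum of squares with positive
weights. The second is that zero is isolated. If one half is gapless, a zero mode has components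
constant along that half, hence vanishes (`ZeroMode.eq_zero_of_gapless`); so a kernel forces both
`δ±` to be nonzero. Then the bulk symbol has a gap, with margin `(d - b)² (d + 2 b) > 0`, and `H 0`
is bounded below modulo the two cells at the interface (`exists_bounded_below_interface`). By
compactness it is bounded below on the orthogonal complement of its kernel (`exists_gap`).

The rest is perturbation theory for `ChiralCrossing`, without analyticity. An approximate null
vector yields a small eigenvalue (`exists_eigenvalue`), chirality yields its negative, a dimension
count excludes a third (`card_eigenvalues_le`), and projecting the eigenvalue equation onto the
kernel gives the modulus up to `O(k²)` (`exists_eigenvalue_bound`). -/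

/-! ### Self-adjoint operators bounded below modulo finite rank -/

section HilbertPerturbation

variable {X : Type*} [NormedAddCommGroup X] [InnerProductSpace ℂ X] [CompleteSpace X]

/-- An operator that is bounded below modulo a map of finite rank is bounded below on every closed
subspace on which it is injective. -/
theorem exists_bounded_below_of_finite_rank {W : Type*} [NormedAddCommGroup W] [NormedSpace ℂ W]
    [FiniteDimensional ℂ W] (T : X →L[ℂ] X) (F : X →L[ℂ] W) {C : ℝ}
    (hC : ∀ u, ‖u‖ ≤ C * (‖T u‖ + ‖F u‖)) (Y : Submodule ℂ X) (hY : IsClosed (Y : Set X))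
    (hinj : ∀ u ∈ Y, T u = 0 → u = 0) :
    ∃ g : ℝ, 0 < g ∧ ∀ u ∈ Y, g * ‖u‖ ≤ ‖T u‖ := by
  by_contra! hcon
  have hseq : ∀ m : ℕ, ∃ u ∈ Y, ‖u‖ = 1 ∧ ‖T u‖ < 1 / ((m : ℝ) + 1) := by
    intro m
    obtain ⟨u, huY, hu⟩ := hcon (1 / ((m : ℝ) + 1)) (by positivity)
    have hu0 : u ≠ 0 := by
      rintro rfl
      simp at hu
    have hn : 0 < ‖u‖ := norm_pos_iff.mpr hu0
    refine ⟨((‖u‖ : ℂ)⁻¹) • u, Y.smul_mem _ huY, ?_, ?_⟩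
    · rw [norm_smul, norm_inv, Complex.norm_real, norm_norm, inv_mul_cancel₀ hn.ne']
    · rw [map_smul, norm_smul, norm_inv, Complex.norm_real, norm_norm, inv_mul_lt_iff₀ hn]
      linarith
  choose v hvY hv1 hvT using hseq
  have : ProperSpace W := FiniteDimensional.proper ℂ W
  have hbdd : ∀ m, F (v m) ∈ Metric.closedBall (0 : W) ‖F‖ := by
    intro m
    rw [mem_closedBall_zero_iff]
    simpa [hv1 m] using F.le_opNorm (v m)
  obtain ⟨a, -, ψ, hψ, hlim⟩ := tendsto_subseq_of_bounded Metric.isBounded_closedBall hbdd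
  have hT0 : Tendsto (fun m => T (v m)) atTop (𝓝 0) :=
    squeeze_zero_norm (fun m => (hvT m).le) tendsto_one_div_add_atTop_nhds_zero_nat
  have hTψ : Tendsto (fun m => T (v (ψ m))) atTop (𝓝 0) := hT0.comp hψ.tendsto_atTop
  -- The hypothesis applied to differences: both `T` and `F` converge along the subsequence, so the
  -- unit vectors themselves are Cauchy.
  have hdist : ∀ m l, dist (v (ψ m)) (v (ψ l)) ≤
      C * (dist (T (v (ψ m))) (T (v (ψ l))) + dist (F (v (ψ m))) (F (v (ψ l)))) := by
    intro m l
    simpa only [dist_eq_norm, map_sub] using hC (v (ψ m) - v (ψ l))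
  have hcauchy : CauchySeq (fun m => v (ψ m)) := by
    have h1 := cauchySeq_iff_tendsto_dist_atTop_0.mp hTψ.cauchySeq
    have h2 := cauchySeq_iff_tendsto_dist_atTop_0.mp hlim.cauchySeq
    rw [cauchySeq_iff_tendsto_dist_atTop_0]
    refine squeeze_zero (fun _ => dist_nonneg) (fun q => hdist q.1 q.2) ?_
    simpa using (h1.add h2).const_mul C
  obtain ⟨u, hu⟩ := cauchySeq_tendsto_of_complete hcauchy
  have huY : u ∈ Y := hY.mem_of_tendsto hu (Eventually.of_forall fun m => hvY _)
  have hTu : T u = 0 := tendsto_nhds_unique ((T.continuous.tendsto u).comp hu) hTψ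
  have hu1 : ‖u‖ = 1 :=
    tendsto_nhds_unique hu.norm (by simpa only [hv1] using tendsto_const_nhds)
  rw [hinj u huY hTu, norm_zero] at hu1
  exact zero_ne_one hu1

/-- A self-adjoint operator that is bounded below is invertible. -/
theorem isUnit_of_isSelfAdjoint_of_bounded_below {T : X →L[ℂ] X} (hT : IsSelfAdjoint T) {g : ℝ}
    (hg : 0 < g) (h : ∀ u, g * ‖u‖ ≤ ‖T u‖) : IsUnit T := by
  have hsym := ContinuousLinearMap.isSelfAdjoint_iff_isSymmetric.mp hT
  -- The square is coercive because `⟪T² x, x⟫ = ‖T x‖²`.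
  have h2 : IsUnit (T ^ 2) := by
    refine ContinuousLinearMap.isUnit_of_forall_le_norm_inner_map (T ^ 2)
      (c := (g ^ 2).toNNReal) (Real.toNNReal_pos.mpr (pow_pos hg 2)) fun x => ?_
    have h3 : inner ℂ ((T ^ 2) x) x = inner ℂ (T x) (T x) := by
      rw [pow_two]
      exact hsym (T x) x
    rw [h3, inner_self_eq_norm_sq_to_K, Real.coe_toNNReal _ (sq_nonneg g), norm_pow,
      RCLike.norm_ofReal, abs_norm, ← mul_pow, mul_comm]
    exact pow_le_pow_left₀ (by positivity) (h x) 2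
  exact (isUnit_pow_iff two_ne_zero).mp h2

/-- A self-adjoint operator with an approximate null vector has spectrum near zero. -/
theorem exists_mem_spectrum_norm_le {T : X →L[ℂ] X} (hT : IsSelfAdjoint T) {φ : X}
    (hφ : ‖φ‖ = 1) {ε : ℝ} (h : ‖T φ‖ ≤ ε) : ∃ z ∈ spectrum ℂ T, ‖z‖ ≤ ε := by
  have hε : 0 ≤ ε := (norm_nonneg _).trans h
  by_cases hu : IsUnit T
  · obtain ⟨U, rfl⟩ := hu
    have : Nontrivial X := ⟨φ, 0, by rintro rfl; simp at hφ⟩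
    have hinv : IsSelfAdjoint ((U⁻¹ : (X →L[ℂ] X)ˣ) : X →L[ℂ] X) := by
      have h1 : IsSelfAdjoint U := Units.ext hT
      have h2 : IsSelfAdjoint U⁻¹ := h1.inv
      exact congrArg Units.val h2
    -- The inverse is self-adjoint, so its norm, which is at least `1 / ε`, is attained as the
    -- modulus of a spectral point `z`; then `z⁻¹` is the required point.
    obtain ⟨z, hz, hzn⟩ := spectrum.exists_nnnorm_eq_spectralRadius
      ((U⁻¹ : (X →L[ℂ] X)ˣ) : X →L[ℂ] X)
    rw [hinv.spectralRadius_eq_nnnorm, ENNReal.coe_inj] at hzn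
    have hzn' : ‖z‖ = ‖((U⁻¹ : (X →L[ℂ] X)ˣ) : X →L[ℂ] X)‖ := congrArg NNReal.toReal hzn
    have hone : 1 ≤ ‖z‖ * ε := by
      have h1 : ((U⁻¹ : (X →L[ℂ] X)ˣ) : X →L[ℂ] X) ((U : X →L[ℂ] X) φ) = φ := by
        rw [← mul_apply_eq_comp, Units.inv_mul, one_apply_eq_self]
      calc (1 : ℝ) = ‖((U⁻¹ : (X →L[ℂ] X)ˣ) : X →L[ℂ] X) ((U : X →L[ℂ] X) φ)‖ := by rw [h1, hφ]
        _ ≤ ‖z‖ * ‖(U : X →L[ℂ] X) φ‖ := by rw [hzn']; exact ContinuousLinearMap.le_opNorm _ _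
        _ ≤ ‖z‖ * ε := by gcongr
    have hz0 : z ≠ 0 := by
      rintro rfl
      norm_num at hone
    refine ⟨z⁻¹, ?_, ?_⟩
    · have := (spectrum.inv_mem_iff (r := (Units.mk0 z hz0)⁻¹) (a := U)).mpr (by simpa using hz)
      simpa using this
    · rw [norm_inv, inv_le_iff_one_le_mul₀ (norm_pos_iff.mpr hz0), mul_comm]
      exact hone
  · exact ⟨0, spectrum.zero_mem ℂ hu, by simpa using hε⟩

/-! ### Perturbation of a two-dimensional kernel with chiral symmetry -/

/-- Data of a chiral self-adjoint family with a two-dimensional, isolated kernel at `k = 0`, spanned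
by orthonormal `φ₁`, `φ₂` which the first-order term of the family couples only to each other. -/
structure ChiralCrossing (H : ℝ → X →L[ℂ] X) (H₁ : X →L[ℂ] X) (φ₁ φ₂ : X) (a : ℂ) (M : ℝ) :
    Prop where
  selfAdjoint : ∀ k, IsSelfAdjoint (H k)
  selfAdjoint_deriv : IsSelfAdjoint H₁
  taylor : ∀ k u, |k| ≤ 1 → ‖H k u - H 0 u - (k : ℂ) • H₁ u‖ ≤ M * k ^ 2 * ‖u‖
  norm_left : ‖φ₁‖ = 1
  norm_right : ‖φ₂‖ = 1
  orthogonal : inner ℂ φ₁ φ₂ = 0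
  map_left : H 0 φ₁ = 0
  map_right : H 0 φ₂ = 0
  ker_le : ∀ u, H 0 u = 0 → ∃ α β : ℂ, u = α • φ₁ + β • φ₂
  inner_left : inner ℂ φ₁ (H₁ φ₁) = 0
  inner_right : inner ℂ φ₂ (H₁ φ₂) = 0
  inner_cross : inner ℂ φ₂ (H₁ φ₁) = a
  cross_ne_zero : a ≠ 0
  chiral : ∀ k (E : ℂ), Module.End.HasEigenvalue (H k : X →ₗ[ℂ] X) E →
    Module.End.HasEigenvalue (H k : X →ₗ[ℂ] X) (-E)

namespace ChiralCrossing

variable {H : ℝ → X →L[ℂ] X} {H₁ : X →L[ℂ] X} {φ₁ φ₂ : X} {a : ℂ} {M : ℝ}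

theorem M_nonneg (h : ChiralCrossing H H₁ φ₁ φ₂ a M) : 0 ≤ M := by
  have := (norm_nonneg _).trans (h.taylor 1 φ₁ (by norm_num))
  simpa [h.norm_left] using this

theorem norm_sub_le (h : ChiralCrossing H H₁ φ₁ φ₂ a M) {k : ℝ} (hk : |k| ≤ 1) (u : X) :
    ‖H k u - H 0 u‖ ≤ (‖H₁‖ + M) * |k| * ‖u‖ := by
  have h1 := h.taylor k u hk
  have h2 : ‖(k : ℂ) • H₁ u‖ ≤ |k| * (‖H₁‖ * ‖u‖) := by
    rw [norm_smul, Complex.norm_real, Real.norm_eq_abs]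
    exact mul_le_mul_of_nonneg_left (H₁.le_opNorm u) (abs_nonneg k)
  have h3 : ‖H k u - H 0 u‖ ≤ ‖H k u - H 0 u - (k : ℂ) • H₁ u‖ + ‖(k : ℂ) • H₁ u‖ := by
    simpa using norm_add_le (H k u - H 0 u - (k : ℂ) • H₁ u) ((k : ℂ) • H₁ u)
  have h4 : M * k ^ 2 * ‖u‖ ≤ M * |k| * ‖u‖ := by
    have : k ^ 2 ≤ |k| := by rw [← sq_abs]; nlinarith [abs_nonneg k]
    have := h.M_nonneg
    gcongr
  nlinarith

/-- Subtracting the projection onto the kernel leaves a vector orthogonal to it. -/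
theorem inner_residual (h : ChiralCrossing H H₁ φ₁ φ₂ a M) (u : X) :
    inner ℂ φ₁ (u - (inner ℂ φ₁ u • φ₁ + inner ℂ φ₂ u • φ₂)) = 0 ∧
    inner ℂ φ₂ (u - (inner ℂ φ₁ u • φ₁ + inner ℂ φ₂ u • φ₂)) = 0 := by
  have h1 : inner ℂ φ₁ φ₁ = 1 := by rw [inner_self_eq_norm_sq_to_K, h.norm_left]; simp
  have h2 : inner ℂ φ₂ φ₂ = 1 := by rw [inner_self_eq_norm_sq_to_K, h.norm_right]; simp
  have h3 : inner ℂ φ₂ φ₁ = 0 := inner_eq_zero_symm.mp h.orthogonal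
  constructor <;>
    simp only [inner_sub_right, inner_add_right, inner_smul_right, h1, h2, h3, h.orthogonal] <;>
    ring

/-- The kernel is the span of `φ₁` and `φ₂`, so `H 0` is injective on the closed orthogonal
complement and the compactness lemma applies there. -/
theorem exists_gap {W : Type*} [NormedAddCommGroup W] [NormedSpace ℂ W] [FiniteDimensional ℂ W]
    (h : ChiralCrossing H H₁ φ₁ φ₂ a M) (F : X →L[ℂ] W) {C : ℝ}
    (hC : ∀ u, ‖u‖ ≤ C * (‖H 0 u‖ + ‖F u‖)) :
    ∃ g : ℝ, 0 < g ∧ ∀ u, inner ℂ φ₁ u = 0 → inner ℂ φ₂ u = 0 → g * ‖u‖ ≤ ‖H 0 u‖ := by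
  obtain ⟨g, hg, hgu⟩ := exists_bounded_below_of_finite_rank (H 0) F hC
    ((Submodule.span ℂ {φ₁, φ₂})ᗮ) (Submodule.isClosed_orthogonal _) (by
      intro u hu hHu
      obtain ⟨α, β, hαβ⟩ := h.ker_le u hHu
      have hmem : u ∈ Submodule.span ℂ {φ₁, φ₂} :=
        Submodule.mem_span_pair.mpr ⟨α, β, hαβ.symm⟩
      exact inner_self_eq_zero.mp (Submodule.inner_right_of_mem_orthogonal hmem hu))
  refine ⟨g, hg, fun u h1 h2 => hgu u ?_⟩
  rw [Submodule.mem_orthogonal]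
  intro v hv
  obtain ⟨α, β, rfl⟩ := Submodule.mem_span_pair.mp hv
  simp [inner_add_left, inner_smul_left, h1, h2]

/-- Fewer than three eigenvalues of `H k` lie close to zero. -/
theorem card_eigenvalues_le (h : ChiralCrossing H H₁ φ₁ φ₂ a M) {g η k : ℝ}
    (hgap : ∀ u, inner ℂ φ₁ u = 0 → inner ℂ φ₂ u = 0 → g * ‖u‖ ≤ ‖H 0 u‖) (hk : |k| ≤ 1)
    (hη : 0 ≤ η) (hsmall : η + (‖H₁‖ + M) * |k| < g) (s : Finset ℂ)
    (hs : ∀ E ∈ s, ‖E‖ ≤ η ∧ Module.End.HasEigenvalue (H k : X →ₗ[ℂ] X) E) : s.card ≤ 2 := by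
  by_contra! hcard
  have hsym := ContinuousLinearMap.isSelfAdjoint_iff_isSymmetric.mp (h.selfAdjoint k)
  have hex : ∀ E : ℂ, ∃ v : Module.End.eigenspace (H k : X →ₗ[ℂ] X) E, E ∈ s → v ≠ 0 := by
    intro E
    by_cases hE : E ∈ s
    · obtain ⟨v, hv, hv0⟩ := (hs E hE).2.exists_hasEigenvector
      exact ⟨⟨v, hv⟩, fun _ h0 => hv0 (congrArg Subtype.val h0)⟩
    · exact ⟨0, fun h0 => absurd h0 hE⟩
  choose v hv using hex
  -- Three or more coefficients against two linear conditions: some nontrivial combination `w` of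
  -- eigenvectors is orthogonal to the kernel of `H 0`. Orthogonality of eigenspaces gives `‖H k w‖
  -- ≤ η ‖w‖`, which contradicts the gap.
  let L : (s → ℂ) →ₗ[ℂ] ℂ × ℂ :=
    { toFun := fun c => (∑ E, c E * inner ℂ φ₁ (v E : X), ∑ E, c E * inner ℂ φ₂ (v E : X))
      map_add' := fun c d => by simp [add_mul, Finset.sum_add_distrib]
      map_smul' := fun r c => by simp [mul_assoc, Finset.mul_sum] }
  obtain ⟨c, hcL, hc0⟩ := Submodule.exists_mem_ne_zero_of_ne_bot
    (L.ker_ne_bot_of_finrank_lt (by simpa using hcard))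
  let c' : ℂ → ℂ := fun E => if hE : E ∈ s then c ⟨E, hE⟩ else 0
  have hc' : ∀ E : s, c' E = c E := fun E => by simp [c']
  let w : X := ∑ E ∈ s, (c' E • v E : Module.End.eigenspace (H k : X →ₗ[ℂ] X) E)
  have hw1 : inner ℂ φ₁ w = 0 := by
    have h1 : ∑ E : s, c E * inner ℂ φ₁ (v E : X) = 0 := congrArg Prod.fst hcL
    simp only [← hc'] at h1
    rw [Finset.sum_coe_sort s (fun E => c' E * inner ℂ φ₁ (v E : X))] at h1
    simpa [w, inner_sum, inner_smul_right] using h1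
  have hw2 : inner ℂ φ₂ w = 0 := by
    have h1 : ∑ E : s, c E * inner ℂ φ₂ (v E : X) = 0 := congrArg Prod.snd hcL
    simp only [← hc'] at h1
    rw [Finset.sum_coe_sort s (fun E => c' E * inner ℂ φ₂ (v E : X))] at h1
    simpa [w, inner_sum, inner_smul_right] using h1
  have hnw : ‖w‖ ^ 2 = ∑ E ∈ s, ‖c' E • v E‖ ^ 2 :=
    hsym.orthogonalFamily_eigenspaces.norm_sum (fun E => c' E • v E) s
  have hHw : H k w = ∑ E ∈ s, ((E • c' E • v E : Module.End.eigenspace (H k : X →ₗ[ℂ] X) E) : X) := by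
    simp only [w, map_sum]
    refine Finset.sum_congr rfl fun E _ => ?_
    exact Module.End.mem_eigenspace_iff.mp (c' E • v E).2
  have hnHw : ‖H k w‖ ^ 2 = ∑ E ∈ s, ‖E • c' E • v E‖ ^ 2 := by
    rw [hHw]
    exact hsym.orthogonalFamily_eigenspaces.norm_sum (fun E => E • c' E • v E) s
  have hle : ‖H k w‖ ≤ η * ‖w‖ := by
    refine abs_le_of_sq_le_sq' ?_ (by positivity) |>.2
    rw [mul_pow, hnHw, hnw, Finset.mul_sum]
    refine Finset.sum_le_sum fun E hE => ?_
    rw [norm_smul, mul_pow]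
    gcongr
    exact (hs E hE).1
  have hw0 : 0 < ‖w‖ := by
    obtain ⟨E, hE⟩ := Function.ne_iff.mp hc0
    have h1 : 0 < ‖c' E • v E‖ ^ 2 := by
      rw [hc' E]
      exact pow_pos (norm_pos_iff.mpr (smul_ne_zero hE (hv E E.2))) 2
    have h2 : ‖c' E • v E‖ ^ 2 ≤ ‖w‖ ^ 2 := by
      rw [hnw]
      exact Finset.single_le_sum (f := fun E => ‖c' E • v E‖ ^ 2) (fun _ _ => sq_nonneg _) E.2
    exact lt_of_pow_lt_pow_left₀ 2 (norm_nonneg w) (by rw [zero_pow two_ne_zero]; exact h1.trans_le h2)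
  have h1 := hgap w hw1 hw2
  have h2 : ‖H 0 w‖ ≤ ‖H k w‖ + ‖H k w - H 0 w‖ := by
    simpa using _root_.norm_sub_le (H k w) (H k w - H 0 w)
  have h3 := h.norm_sub_le hk w
  nlinarith

/-- Small eigenvalues of `H k` have modulus `‖a‖ * |k| + O(k ^ 2)`. -/
theorem exists_eigenvalue_bound (h : ChiralCrossing H H₁ φ₁ φ₂ a M) {g : ℝ} (hg : 0 < g)
    (hgap : ∀ u, inner ℂ φ₁ u = 0 → inner ℂ φ₂ u = 0 → g * ‖u‖ ≤ ‖H 0 u‖) :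
    ∃ η C r : ℝ, 0 < η ∧ 0 < r ∧ r ≤ 1 ∧ ∀ k (E : ℂ), |k| < r → ‖E‖ < η →
      Module.End.HasEigenvalue (H k : X →ₗ[ℂ] X) E → |(‖E‖ - ‖a‖ * |k|)| ≤ C * k ^ 2 := by
  set N := ‖H₁‖ + M with hN
  have hM := h.M_nonneg
  have hN0 : 0 ≤ N := by positivity
  have hNle : ‖H₁‖ ≤ N := by linarith
  have hMle : M ≤ N := by linarith [norm_nonneg H₁]
  set D := 4 * N / g with hD
  have hD0 : 0 ≤ D := by positivity
  -- The choices `g / 4` and `g / (4 (N + 1))` keep the part of a unit eigenvector off the kernel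
  -- below `1/2`; the bound `1 / (2 (D + 1))` lets `|k| D Δ` be absorbed into `Δ / 2` at the end.
  refine ⟨g / 4, 2 * (4 * N + D * (‖a‖ + N)), min (1 / 2) (min (g / (4 * (N + 1))) (1 / (2 * (D + 1)))),
    by positivity, by positivity, (min_le_left _ _).trans (by norm_num), ?_⟩
  intro k E hk hE hev
  have hk1 : |k| ≤ 1 := by linarith [hk.trans_le (min_le_left _ _)]
  have hk2 : |k| * (4 * (N + 1)) < g :=
    (lt_div_iff₀ (by positivity)).mp (hk.trans_le ((min_le_right _ _).trans (min_le_left _ _)))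
  have hk3 : |k| * (2 * (D + 1)) < 1 :=
    (lt_div_iff₀ (by positivity)).mp (hk.trans_le ((min_le_right _ _).trans (min_le_right _ _)))
  have hk0 := abs_nonneg k
  obtain ⟨u₀, hu₀, hu₀0⟩ := hev.exists_hasEigenvector
  obtain ⟨u, hHu, hu1⟩ : ∃ u : X, H k u = E • u ∧ ‖u‖ = 1 := by
    have hn : 0 < ‖u₀‖ := norm_pos_iff.mpr hu₀0
    refine ⟨((‖u₀‖ : ℂ)⁻¹) • u₀, ?_, ?_⟩
    · rw [map_smul, show H k u₀ = E • u₀ from Module.End.mem_eigenspace_iff.mp hu₀, smul_comm]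
    · rw [norm_smul, norm_inv, Complex.norm_real, norm_norm, inv_mul_cancel₀ hn.ne']
  set α := inner ℂ φ₁ u with hα
  set β := inner ℂ φ₂ u with hβ
  set w := u - (α • φ₁ + β • φ₂) with hw
  obtain ⟨hw1, hw2⟩ := h.inner_residual u
  rw [← hα, ← hβ, ← hw] at hw1 hw2
  have hu : u = α • φ₁ + β • φ₂ + w := by rw [hw]; abel
  have hHw : H 0 w = H 0 u := by
    rw [hw, map_sub, map_add, map_smul, map_smul, h.map_left, h.map_right]; simp
  have hwn : g * ‖w‖ ≤ ‖E‖ + N * |k| := by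
    have h1 := hgap w hw1 hw2
    have h2 : ‖H 0 u‖ ≤ ‖H k u‖ + ‖H k u - H 0 u‖ := by
      simpa using _root_.norm_sub_le (H k u) (H k u - H 0 u)
    have h3 := h.norm_sub_le hk1 u
    rw [hHw] at h1
    rw [hHu, norm_smul, hu1] at h2
    rw [hHu, hu1] at h3
    linarith
  have hsum : 1 / 2 ≤ ‖α‖ + ‖β‖ := by
    have h1 : ‖u‖ ≤ ‖α‖ + ‖β‖ + ‖w‖ := by
      calc ‖u‖ = ‖α • φ₁ + β • φ₂ + w‖ := by rw [← hu]
        _ ≤ ‖α • φ₁‖ + ‖β • φ₂‖ + ‖w‖ := norm_add₃_le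
        _ = _ := by rw [norm_smul, norm_smul, h.norm_left, h.norm_right, mul_one, mul_one]
    have h2 : ‖w‖ ≤ 1 / 2 := by
      by_contra! hcon
      nlinarith
    linarith
  have hsymk := ContinuousLinearMap.isSelfAdjoint_iff_isSymmetric.mp (h.selfAdjoint k)
  have hsym0 := ContinuousLinearMap.isSelfAdjoint_iff_isSymmetric.mp (h.selfAdjoint 0)
  have hsym1 := ContinuousLinearMap.isSelfAdjoint_iff_isSymmetric.mp h.selfAdjoint_deriv
  have hcross : inner ℂ φ₁ (H₁ φ₂) = starRingEnd ℂ a := by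
    rw [← h.inner_cross, inner_conj_symm]
    exact (hsym1 φ₁ φ₂).symm
  -- Pairing the eigenvalue equation with a kernel vector removes `H 0`. With `φ₁` and `φ₂` this
  -- gives `E α ≈ k ā β` and `E β ≈ k a α`.
  have key : ∀ (φ : X) (z : ℂ), ‖φ‖ = 1 → H 0 φ = 0 →
      inner ℂ φ (H₁ u) = z + inner ℂ φ (H₁ w) →
      ‖E * inner ℂ φ u - k * z‖ ≤ N * k ^ 2 + |k| * (N * ‖w‖) := by
    intro φ z hφ hφ0 hz
    have e1 : inner ℂ φ (H k u - H 0 u - (k : ℂ) • H₁ u) =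
        E * inner ℂ φ u - k * z - k * inner ℂ φ (H₁ w) := by
      have e2 : inner ℂ φ (H 0 u) = 0 := by
        have := hsym0 φ u
        simp only [ContinuousLinearMap.coe_coe, hφ0, inner_zero_left] at this
        exact this.symm
      rw [inner_sub_right, inner_sub_right, e2, inner_smul_right, hz, hHu, inner_smul_right]
      ring
    have e3 : ‖inner ℂ φ (H k u - H 0 u - (k : ℂ) • H₁ u)‖ ≤ N * k ^ 2 := by
      refine (norm_inner_le_norm _ _).trans ?_
      rw [hφ, one_mul]
      refine (h.taylor k u hk1).trans ?_
      rw [hu1, mul_one]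
      gcongr
    have e4 : ‖(k : ℂ) * inner ℂ φ (H₁ w)‖ ≤ |k| * (N * ‖w‖) := by
      rw [norm_mul, Complex.norm_real, Real.norm_eq_abs]
      gcongr
      refine (norm_inner_le_norm _ _).trans ?_
      rw [hφ, one_mul]
      exact (H₁.le_opNorm w).trans (by gcongr)
    have e5 : E * inner ℂ φ u - k * z = inner ℂ φ (H k u - H 0 u - (k : ℂ) • H₁ u) +
        (k : ℂ) * inner ℂ φ (H₁ w) := by rw [e1]; ring
    rw [e5]
    exact (norm_add_le _ _).trans (add_le_add e3 e4)
  have k1 := key φ₁ (starRingEnd ℂ a * β) h.norm_left h.map_left (by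
    conv_lhs => rw [hu]
    rw [map_add, map_add, map_smul, map_smul, inner_add_right, inner_add_right, inner_smul_right,
      inner_smul_right, h.inner_left, hcross]
    ring)
  have k2 := key φ₂ (a * α) h.norm_right h.map_right (by
    conv_lhs => rw [hu]
    rw [map_add, map_add, map_smul, map_smul, inner_add_right, inner_add_right, inner_smul_right,
      inner_smul_right, h.inner_right, h.inner_cross]
    ring)
  rw [← hα] at k1
  rw [← hβ] at k2
  have l1 : |‖E‖ * ‖α‖ - ‖a‖ * |k| * ‖β‖| ≤ N * k ^ 2 + |k| * (N * ‖w‖) := by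
    refine le_trans ?_ k1
    refine le_trans (le_of_eq ?_) (abs_norm_sub_norm_le _ _)
    simp only [norm_mul, Complex.norm_real, Real.norm_eq_abs, RCLike.norm_conj]
    congr 1; ring
  have l2 : |‖E‖ * ‖β‖ - ‖a‖ * |k| * ‖α‖| ≤ N * k ^ 2 + |k| * (N * ‖w‖) := by
    refine le_trans ?_ k2
    refine le_trans (le_of_eq ?_) (abs_norm_sub_norm_le _ _)
    simp only [norm_mul, Complex.norm_real, Real.norm_eq_abs]
    congr 1; ring
  set Δ := |(‖E‖ - ‖a‖ * |k|)| with hΔ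
  have hΔ0 : 0 ≤ Δ := abs_nonneg _
  -- Adding the two modulus relations symmetrizes in `α` and `β` and factors out `‖E‖ - ‖a‖ |k|`, so
  -- no phases have to be solved for.
  have l3 : Δ * (‖α‖ + ‖β‖) ≤ 2 * (N * k ^ 2 + |k| * (N * ‖w‖)) := by
    rw [hΔ, ← abs_of_nonneg (show 0 ≤ ‖α‖ + ‖β‖ by positivity), ← abs_mul]
    calc |(‖E‖ - ‖a‖ * |k|) * (‖α‖ + ‖β‖)|
        = |(‖E‖ * ‖α‖ - ‖a‖ * |k| * ‖β‖) + (‖E‖ * ‖β‖ - ‖a‖ * |k| * ‖α‖)| := by congr 1; ring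
      _ ≤ _ := abs_add_le _ _
      _ ≤ _ := by linarith
  have l4 : Δ ≤ 4 * (N * k ^ 2 + |k| * (N * ‖w‖)) := by nlinarith
  have l5 : ‖E‖ ≤ Δ + ‖a‖ * |k| := by linarith [le_abs_self (‖E‖ - ‖a‖ * |k|)]
  -- The bound on `w` involves `‖E‖`, which is itself `Δ + O(k)`; this makes the error `O(k²)` plus
  -- a multiple of `|k| Δ`.
  have l6 : 4 * (N * ‖w‖) ≤ D * (Δ + (‖a‖ + N) * |k|) := by
    have : 4 * (N * ‖w‖) = D * (g * ‖w‖) := by rw [hD]; field_simp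
    rw [this]
    gcongr
    linarith
  have l7 : |k| * (4 * (N * ‖w‖)) ≤ |k| * (D * (Δ + (‖a‖ + N) * |k|)) := by gcongr
  have l8 : |k| * D * Δ ≤ Δ / 2 := by nlinarith
  have hkk : |k| * |k| = k ^ 2 := by rw [← pow_two, sq_abs]
  have l9 : |k| * (D * (Δ + (‖a‖ + N) * |k|)) = |k| * D * Δ + D * (‖a‖ + N) * k ^ 2 := by
    rw [← hkk]; ring
  linarith

/-- `H k` has an eigenvalue within `O(k)` of zero. -/
theorem exists_eigenvalue {W : Type*} [NormedAddCommGroup W] [NormedSpace ℂ W]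
    [FiniteDimensional ℂ W] (h : ChiralCrossing H H₁ φ₁ φ₂ a M) (F : X →L[ℂ] W) {C k : ℝ}
    (hC : ∀ u, ‖u‖ ≤ C * (‖H 0 u‖ + ‖F u‖)) (hC0 : 0 ≤ C) (hk : |k| ≤ 1)
    (hsmall : C * (2 * ((‖H₁‖ + M) * |k|)) ≤ 1 / 2) :
    ∃ E : ℂ, ‖E‖ ≤ (‖H₁‖ + M) * |k| ∧ Module.End.HasEigenvalue (H k : X →ₗ[ℂ] X) E := by
  obtain ⟨E, hE, hEn⟩ := exists_mem_spectrum_norm_le (h.selfAdjoint k) h.norm_left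
    (ε := (‖H₁‖ + M) * |k|) (by
      have := h.norm_sub_le hk φ₁
      rwa [h.map_left, sub_zero, h.norm_left, mul_one] at this)
  refine ⟨E, hEn, ?_⟩
  by_contra hnot
  have hreal : E = (E.re : ℂ) := (h.selfAdjoint k).mem_spectrum_eq_re hE
  set T : X →L[ℂ] X := H k - algebraMap ℂ (X →L[ℂ] X) E with hT
  have hTa : ∀ u, T u = H k u - E • u := fun u => by
    simp [hT, ContinuousLinearMap.algebraMap_apply]
  have hTsa : IsSelfAdjoint T := by
    refine (h.selfAdjoint k).sub ?_
    rw [isSelfAdjoint_iff, ← algebraMap_star_comm, hreal]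
    simp
  -- The estimate for `H 0` survives the perturbation: the error is at most `‖u‖ / 2`, and absorbing
  -- it doubles the constant.
  have hest : ∀ u, ‖u‖ ≤ (2 * C) * (‖T u‖ + ‖F u‖) := by
    intro u
    have h1 := h.norm_sub_le hk u
    have h2 : ‖H 0 u‖ ≤ ‖T u‖ + ‖E • u‖ + ‖H k u - H 0 u‖ := by
      have e : H 0 u = T u + E • u - (H k u - H 0 u) := by rw [hTa]; abel
      calc ‖H 0 u‖ = ‖T u + E • u - (H k u - H 0 u)‖ := by rw [← e]
        _ ≤ ‖T u + E • u‖ + ‖H k u - H 0 u‖ := _root_.norm_sub_le _ _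
        _ ≤ _ := by gcongr; exact norm_add_le _ _
    have h3 : ‖E • u‖ ≤ (‖H₁‖ + M) * |k| * ‖u‖ := by rw [norm_smul]; gcongr
    have h4 : ‖u‖ ≤ C * (‖T u‖ + ‖F u‖ + 2 * ((‖H₁‖ + M) * |k|) * ‖u‖) := by
      exact (hC u).trans (mul_le_mul_of_nonneg_left (by linarith) hC0)
    have h5 : C * (2 * ((‖H₁‖ + M) * |k|)) * ‖u‖ ≤ 1 / 2 * ‖u‖ := by gcongr
    linarith
  -- If `E` were not an eigenvalue, `T` would be injective, hence bounded below on the whole space,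
  -- hence invertible, although `E` is in the spectrum.
  obtain ⟨g, hg, hgu⟩ := exists_bounded_below_of_finite_rank T F hest ⊤ isClosed_univ (by
    intro u _ hu
    by_contra hu0
    exact hnot (Module.End.hasEigenvalue_of_hasEigenvector (x := u)
      ⟨Module.End.mem_eigenspace_iff.mpr (sub_eq_zero.mp ((hTa u).symm.trans hu)), hu0⟩))
  have hunit := isUnit_of_isSelfAdjoint_of_bounded_below hTsa hg fun u => hgu u trivial
  rw [spectrum.mem_iff, ← IsUnit.neg_iff, neg_sub] at hE
  exact hE hunit

/-- For small `k` the eigenvalues of `H k` near zero are `± e k` with `e k = ‖a‖ * |k| + O(k ^ 2)`. -/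
theorem exists_branches {W : Type*} [NormedAddCommGroup W] [NormedSpace ℂ W]
    [FiniteDimensional ℂ W] (h : ChiralCrossing H H₁ φ₁ φ₂ a M) (F : X →L[ℂ] W) {C : ℝ}
    (hC : ∀ u, ‖u‖ ≤ C * (‖H 0 u‖ + ‖F u‖)) :
    ∃ (η C' r : ℝ) (e : ℝ → ℝ), 0 < η ∧ 0 < r ∧ ∀ k, |k| < r →
      {E : ℂ | ‖E‖ < η ∧ Module.End.HasEigenvalue (H k : X →ₗ[ℂ] X) E}
        = {((-e k : ℝ) : ℂ), (e k : ℂ)} ∧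
      (k ≠ 0 → 0 < e k) ∧ |(e k - ‖a‖ * |k|)| ≤ C' * k ^ 2 := by
  have hC0 : 0 ≤ C := by
    by_contra! hneg
    have h1 := hC φ₁
    rw [h.norm_left] at h1
    have : 0 ≤ ‖H 0 φ₁‖ + ‖F φ₁‖ := by positivity
    nlinarith
  obtain ⟨g, hg, hgap⟩ := h.exists_gap F hC
  obtain ⟨η₀, C', r₀, hη₀, hr₀, hr₁, hasym⟩ := h.exists_eigenvalue_bound hg hgap
  have ha : 0 < ‖a‖ := norm_pos_iff.mpr h.cross_ne_zero
  have hM := h.M_nonneg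
  set N := ‖H₁‖ + M with hN
  have hN0 : 0 ≤ N := by positivity
  -- The bound `η₀` serves the asymptotics; `g / 2`, together with `N |k| < g / 2`, serves the count
  -- of eigenvalues.
  set η := min η₀ (g / 2) with hη
  have hη0 : 0 < η := by positivity
  have hfin : ∃ r, 0 < r ∧ ∀ k : ℝ, |k| < r →
      |k| < r₀ ∧ N * |k| < g / 2 ∧ N * |k| < η ∧ C * (2 * (N * |k|)) < 1 / 2 ∧ C' * |k| < ‖a‖ := by
    have hev : ∀ (c t : ℝ), 0 < t → ∀ᶠ k : ℝ in 𝓝 0, c * |k| < t := by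
      intro c t ht
      have : Tendsto (fun k : ℝ => c * |k|) (𝓝 0) (𝓝 (c * |0|)) :=
        (continuous_const.mul continuous_abs).tendsto 0
      rw [abs_zero, mul_zero] at this
      exact this.eventually_lt_const ht
    have hall := ((hev 1 r₀ hr₀).and ((hev N (g / 2) (by positivity)).and
      ((hev N η hη0).and ((hev (C * 2 * N) (1 / 2) (by norm_num)).and (hev C' ‖a‖ ha)))))
    obtain ⟨r, hr, hball⟩ := Metric.eventually_nhds_iff.mp hall
    refine ⟨r, hr, fun k hk => ?_⟩
    obtain ⟨h1, h2, h3, h4, h5⟩ := hball (y := k) (by simpa using hk)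
    exact ⟨by simpa using h1, h2, h3, by linarith, h5⟩
  obtain ⟨r, hr, hrk⟩ := hfin
  have hmain : ∀ k : ℝ, ∃ e : ℝ, |k| < r →
      {E : ℂ | ‖E‖ < η ∧ Module.End.HasEigenvalue (H k : X →ₗ[ℂ] X) E}
        = {((-e : ℝ) : ℂ), (e : ℂ)} ∧
      (k ≠ 0 → 0 < e) ∧ |(e - ‖a‖ * |k|)| ≤ C' * k ^ 2 := by
    intro k
    by_cases hk : |k| < r
    swap
    · exact ⟨0, fun hcon => absurd hcon hk⟩
    obtain ⟨h1, h2, h3, h4, h5⟩ := hrk k hk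
    obtain ⟨E, hE, hEv⟩ := h.exists_eigenvalue F hC hC0 (h1.le.trans hr₁) h4.le
    have hEη : ‖E‖ < η := hE.trans_lt h3
    have hsym := ContinuousLinearMap.isSelfAdjoint_iff_isSymmetric.mp (h.selfAdjoint k)
    have hEreal : ((E.re : ℝ) : ℂ) = E := Complex.conj_eq_iff_re.mp (hsym.conj_eigenvalue_eq_self hEv)
    have habs : ‖E‖ = |E.re| := by rw [← hEreal]; simp
    have hneg : Module.End.HasEigenvalue (H k : X →ₗ[ℂ] X) (-E) := h.chiral k E hEv
    have hpm : ((|E.re| : ℝ) : ℂ) = E ∨ ((|E.re| : ℝ) : ℂ) = -E := by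
      rcases abs_choice E.re with h6 | h6 <;> rw [h6]
      · exact Or.inl hEreal
      · right; rw [Complex.ofReal_neg, hEreal]
    have hpos : Module.End.HasEigenvalue (H k : X →ₗ[ℂ] X) ((|E.re| : ℝ) : ℂ) := by
      rcases hpm with h6 | h6 <;> rw [h6] <;> assumption
    have hpos' : Module.End.HasEigenvalue (H k : X →ₗ[ℂ] X) ((-|E.re| : ℝ) : ℂ) := by
      rw [Complex.ofReal_neg]
      exact h.chiral k _ hpos
    have hb := hasym k E h1 (hEη.trans_le (min_le_left _ _)) hEv
    have hposk : k ≠ 0 → 0 < |E.re| := by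
      intro hk0
      have hk0' : 0 < |k| := abs_pos.mpr hk0
      have h6 := (abs_le.mp hb).1
      have h7 : C' * k ^ 2 < ‖a‖ * |k| := by
        rw [← sq_abs, pow_two, ← mul_assoc]
        gcongr
      rw [← habs]
      linarith
    refine ⟨|E.re|, fun _ => ⟨?_, hposk, habs ▸ hb⟩⟩
    ext z
    simp only [Set.mem_ofPred_eq, Set.mem_insert_iff, Set.mem_singleton_iff]
    constructor
    · rintro ⟨hz, hzv⟩
      -- At `k = 0` both branches coincide and the asymptotic bound forces `z = 0`; for `k ≠ 0` they
      -- are distinct and a third eigenvalue would violate the count.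
      by_cases hk0 : k = 0
      · subst hk0
        have e1 := hasym 0 z h1 (hz.trans_le (min_le_left _ _)) hzv
        have e2 : z = 0 := by simpa using e1
        have e3 : |E.re| = 0 := by rw [← habs]; simpa using hb
        left
        rw [e2, e3]; simp
      · by_contra! hcon
        have hlt := hposk hk0
        have hne : ((-|E.re| : ℝ) : ℂ) ≠ ((|E.re| : ℝ) : ℂ) := by
          rw [Ne, Complex.ofReal_inj]; linarith
        have hcard := h.card_eigenvalues_le hgap (η := g / 2) (h1.le.trans hr₁) (by positivity)
          (by linarith) {z, ((-|E.re| : ℝ) : ℂ), ((|E.re| : ℝ) : ℂ)} (by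
            have hEg : ‖E‖ ≤ g / 2 := (hEη.trans_le (min_le_right _ _)).le
            intro E' hE'
            simp only [Finset.mem_insert, Finset.mem_singleton] at hE'
            rcases hE' with rfl | rfl | rfl
            · exact ⟨(hz.trans_le (min_le_right _ _)).le, hzv⟩
            · exact ⟨by simpa [habs] using hEg, hpos'⟩
            · exact ⟨by simpa [habs] using hEg, hpos⟩)
        rw [Finset.card_eq_three.mpr ⟨_, _, _, hcon.1, hcon.2, hne, rfl⟩] at hcard
        omega
    · rintro (rfl | rfl)
      · exact ⟨by simpa [habs] using hEη, hpos'⟩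
      · exact ⟨by simpa [habs] using hEη, hpos⟩
  choose e he using hmain
  exact ⟨η, C', r, e, hη0, hr, fun k hk => he k hk⟩

end ChiralCrossing

end HilbertPerturbation

/-! ### Symmetries and first-order expansion of the edge Hamiltonian -/

section EdgeOperators

/-- The cell space `ℂ⁶`. -/
local notation "Cell" => EuclideanSpace ℂ (Fin 6)

theorem conj_phase (k : ℝ) : starRingEnd ℂ (phase k) = phase (-k) := by
  rw [phase, phase, ← Complex.exp_conj]
  simp

theorem phase_eq (k : ℝ) : phase k = (Real.cos k : ℂ) + (Real.sin k : ℂ) * Complex.I := by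
  rw [phase, mul_comm, Complex.exp_mul_I]
  simp

theorem hasSum_eq_zero_of_telescoping {f g : ℤ → ℂ} {s : ℂ} (hf : HasSum f s) (hg : Summable g)
    (h : ∀ n, f n = g n - g (n - 1)) : s = 0 := by
  have h1 : HasSum (fun n : ℤ => g (n - 1)) (∑' n, g n) :=
    (Equiv.subRight (1 : ℤ)).hasSum_iff.mpr hg.hasSum
  have h2 := hg.hasSum.sub h1
  rw [sub_self] at h2
  rw [show f = fun n => g n - g (n - 1) from funext h] at hf
  exact hf.unique h2

theorem summable_norm_sq (u : EdgeSpace) : Summable fun n : ℤ => ‖u n‖ ^ 2 :=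
  (hasSum_norm_sq u).summable

theorem summable_norm_sq_succ (u : EdgeSpace) : Summable fun n : ℤ => ‖u (n + 1)‖ ^ 2 :=
  (Equiv.addRight (1 : ℤ)).summable_iff.mpr (summable_norm_sq u)

theorem norm_mul_le_half {x y : ℂ} {A B : ℝ} (hx : ‖x‖ ≤ A) (hy : ‖y‖ ≤ B) :
    ‖x * y‖ ≤ (A ^ 2 + B ^ 2) / 2 := by
  rw [norm_mul]
  have h1 := mul_le_mul hx hy (norm_nonneg _) ((norm_nonneg x).trans hx)
  nlinarith [sq_nonneg (A - B)]

theorem norm_cI_le (p : HoppingParameters) (n : ℤ) : ‖(p.cI n : ℂ)‖ ≤ p.bound := by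
  rw [Complex.norm_real, Real.norm_eq_abs]
  exact p.abs_aI_le (n + 1)

theorem summable_bond (p : HoppingParameters) (w : ℂ) (u v : EdgeSpace) (i j : Fin 6) :
    Summable fun n : ℤ => (p.cI n : ℂ) * w * (u (n + 1) i * starRingEnd ℂ (v n j)) := by
  refine Summable.of_norm_bounded (g := fun n : ℤ => p.bound * ‖w‖ *
    ((‖u (n + 1)‖ ^ 2 + ‖v n‖ ^ 2) / 2)) ?_ fun n => ?_
  · exact (((summable_norm_sq_succ u).add (summable_norm_sq v)).div_const 2).mul_left _
  · rw [norm_mul, norm_mul]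
    have h1 := norm_mul_le_half (PiLp.norm_apply_le (u (n + 1)) i)
      ((RCLike.norm_conj (v n j)).le.trans (PiLp.norm_apply_le (v n) j))
    have h2 := norm_cI_le p n
    have h3 := p.bound_nonneg
    gcongr

/-- Couplings within a cell cancel cell by cell. Those across a bond cancel only between
neighbouring cells, so the difference of the two inner products is a telescoping series of summable
bond terms. -/
theorem hamiltonianI_isSymmetric (p : HoppingParameters) (k : ℝ) :
    (hamiltonianI p k : EdgeSpace →ₗ[ℂ] EdgeSpace).IsSymmetric := by
  intro u v
  rw [← sub_eq_zero]
  have hs := (lp.hasSum_inner (𝕜 := ℂ) (hamiltonianI p k u) v).sub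
    (lp.hasSum_inner (𝕜 := ℂ) u (hamiltonianI p k v))
  let g : ℤ → ℂ := fun n =>
    -((p.cI n : ℂ) * 1 * starRingEnd ℂ (u (n + 1) 3 * starRingEnd ℂ (v n 2)))
      - (p.cI n : ℂ) * phase (-k) * starRingEnd ℂ (u (n + 1) 0 * starRingEnd ℂ (v n 5))
      + (p.cI n : ℂ) * 1 * (v (n + 1) 3 * starRingEnd ℂ (u n 2))
      + (p.cI n : ℂ) * phase k * (v (n + 1) 0 * starRingEnd ℂ (u n 5))
  refine hasSum_eq_zero_of_telescoping hs (g := g) ?_ ?_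
  · have hconj : ∀ (w : ℂ) (i j : Fin 6), Summable fun n : ℤ =>
        (p.cI n : ℂ) * w * starRingEnd ℂ (u (n + 1) i * starRingEnd ℂ (v n j)) := by
      intro w i j
      have h1 := (summable_bond p (starRingEnd ℂ w) u v i j).star
      refine h1.congr fun n => ?_
      simp only [star_mul', RCLike.star_def, Complex.conj_conj, Complex.conj_ofReal, map_mul]
    exact ((((hconj _ _ _).neg.sub (hconj _ _ _)).add (summable_bond p _ v u _ _))).add
      (summable_bond p _ v u _ _)
  · intro n
    simp only [g]
    rw [hamiltonianI_apply, hamiltonianI_apply, PiLp.inner_apply, PiLp.inner_apply,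
      Fin.sum_univ_six, Fin.sum_univ_six]
    simp only [hamActionI, RCLike.inner_apply, map_sub, map_mul, map_neg, Complex.conj_ofReal,
      conj_phase, neg_neg, sub_add_cancel, Complex.conj_conj, PiLp.toLp_apply, Matrix.cons_val]
    ring

theorem hamiltonianI_isSelfAdjoint (p : HoppingParameters) (k : ℝ) :
    IsSelfAdjoint (hamiltonianI p k) :=
  ContinuousLinearMap.isSelfAdjoint_iff_isSymmetric.mpr (hamiltonianI_isSymmetric p k)

/-- A linear map of the cell space acting in every cell. -/
noncomputable def cellwise (L : Cell →ₗ[ℂ] Cell) : EdgeSpace →L[ℂ] EdgeSpace :=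
  lp.mapCLM 2 (fun _ : ℤ => L.toContinuousLinearMap) (norm_nonneg L.toContinuousLinearMap)
    fun _ => le_rfl

theorem cellwise_apply (L : Cell →ₗ[ℂ] Cell) (u : EdgeSpace) (n : ℤ) :
    cellwise L u n = L (u n) := rfl

/-- The chiral symmetry of a cell: the sign changes on the second sublattice. -/
noncomputable def chiralCell : Cell →ₗ[ℂ] Cell where
  toFun x := !₂[x 0, x 1, x 2, -x 3, -x 4, -x 5]
  map_add' x y := by ext j; fin_cases j <;> simp <;> ring
  map_smul' r x := by ext j; fin_cases j <;> simp

/-- The exchange of the two sublattices of a cell. -/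
noncomputable def swapCell : Cell →ₗ[ℂ] Cell where
  toFun x := !₂[x 3, x 4, x 5, x 0, x 1, x 2]
  map_add' x y := by ext j; fin_cases j <;> simp
  map_smul' r x := by ext j; fin_cases j <;> simp

theorem chiralCell_apply (x : Cell) :
    chiralCell x = !₂[x 0, x 1, x 2, -x 3, -x 4, -x 5] := rfl

theorem swapCell_apply (x : Cell) : swapCell x = !₂[x 3, x 4, x 5, x 0, x 1, x 2] := rfl

theorem hamiltonianI_chiral (p : HoppingParameters) (k : ℝ) (u : EdgeSpace) :
    hamiltonianI p k (cellwise chiralCell u) = -cellwise chiralCell (hamiltonianI p k u) := by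
  refine lp.ext (funext fun n => ?_)
  rw [lp.coeFn_neg, Pi.neg_apply, cellwise_apply, hamiltonianI_apply, hamiltonianI_apply]
  ext j
  fin_cases j <;> simp [hamActionI, cellwise_apply, chiralCell_apply] <;> ring

theorem hamiltonianI_zero_swap (p : HoppingParameters) (u : EdgeSpace) :
    hamiltonianI p 0 (cellwise swapCell u) = cellwise swapCell (hamiltonianI p 0 u) := by
  refine lp.ext (funext fun n => ?_)
  rw [cellwise_apply, hamiltonianI_apply, hamiltonianI_apply]
  ext j
  fin_cases j <;> simp [hamActionI, cellwise_apply, swapCell_apply, phase]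

theorem cellwise_chiralCell_involutive (u : EdgeSpace) :
    cellwise chiralCell (cellwise chiralCell u) = u := by
  refine lp.ext (funext fun n => ?_)
  rw [cellwise_apply, cellwise_apply]
  ext j
  fin_cases j <;> simp [chiralCell_apply]

theorem cellwise_swapCell_involutive (u : EdgeSpace) :
    cellwise swapCell (cellwise swapCell u) = u := by
  refine lp.ext (funext fun n => ?_)
  rw [cellwise_apply, cellwise_apply]
  ext j
  fin_cases j <;> simp [swapCell_apply]

theorem cellwise_chiral_swap (u : EdgeSpace) :
    cellwise chiralCell (cellwise swapCell u) = -cellwise swapCell (cellwise chiralCell u) := by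
  refine lp.ext (funext fun n => ?_)
  rw [lp.coeFn_neg, Pi.neg_apply]
  simp only [cellwise_apply]
  ext j
  fin_cases j <;> simp [swapCell_apply, chiralCell_apply]

theorem norm_cellwise_swapCell (u : EdgeSpace) : ‖cellwise swapCell u‖ = ‖u‖ := by
  have h1 := hasSum_norm_sq (cellwise swapCell u)
  have h2 : ∀ n, ‖cellwise swapCell u n‖ ^ 2 = ‖u n‖ ^ 2 := fun n => by
    rw [cellwise_apply, EuclideanSpace.norm_sq_eq, EuclideanSpace.norm_sq_eq, Fin.sum_univ_six,
      Fin.sum_univ_six]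
    simp [swapCell_apply]
    ring
  simp only [h2] at h1
  exact (pow_left_inj₀ (norm_nonneg _) (norm_nonneg _) two_ne_zero).mp
    (h1.unique (hasSum_norm_sq u))

/-- The chiral involution anticommutes with the Hamiltonian, so it carries eigenvectors for `E` to
eigenvectors for `-E`. -/
theorem hasEigenvalue_neg (p : HoppingParameters) (k : ℝ) (E : ℂ)
    (h : Module.End.HasEigenvalue (hamiltonianI p k : EdgeSpace →ₗ[ℂ] EdgeSpace) E) :
    Module.End.HasEigenvalue (hamiltonianI p k : EdgeSpace →ₗ[ℂ] EdgeSpace) (-E) := by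
  obtain ⟨u, hu, hu0⟩ := h.exists_hasEigenvector
  have hu' : hamiltonianI p k u = E • u := Module.End.mem_eigenspace_iff.mp hu
  refine Module.End.hasEigenvalue_of_hasEigenvector (x := cellwise chiralCell u)
    ⟨Module.End.mem_eigenspace_iff.mpr ?_, fun h0 => hu0 ?_⟩
  · rw [ContinuousLinearMap.coe_coe, hamiltonianI_chiral, hu', map_smul, neg_smul]
  · rw [← cellwise_chiralCell_involutive u, h0, map_zero]

/-- The derivative of `k ↦ hamiltonianI p k` at `k = 0`. -/
noncomputable def hamiltonianDeriv (p : HoppingParameters) : EdgeSpace →L[ℂ] EdgeSpace :=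
  hamiltonianI p (Real.pi / 2) - (1 / 2 : ℂ) • (hamiltonianI p 0 + hamiltonianI p Real.pi)

theorem hamiltonianDeriv_isSelfAdjoint (p : HoppingParameters) :
    IsSelfAdjoint (hamiltonianDeriv p) :=
  (hamiltonianI_isSelfAdjoint p _).sub
    ((show IsSelfAdjoint (1 / 2 : ℂ) by simp [isSelfAdjoint_iff]).smul
      ((hamiltonianI_isSelfAdjoint p _).add (hamiltonianI_isSelfAdjoint p _)))

theorem hamiltonianDeriv_apply (p : HoppingParameters) (u : EdgeSpace) (n : ℤ) :
    hamiltonianDeriv p u n =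
      !₂[Complex.I * p.cI (n - 1) * u (n - 1) 5, -(Complex.I * p.dI n * u n 4), 0, 0,
        Complex.I * p.dI n * u n 1, -(Complex.I * p.cI n * u (n + 1) 0)] := by
  have h : hamiltonianDeriv p u n = hamActionI p (Real.pi / 2) u n -
      (1 / 2 : ℂ) • (hamActionI p 0 u n + hamActionI p Real.pi u n) := rfl
  rw [h]
  ext j
  fin_cases j <;> simp [hamActionI, phase_eq] <;> ring

/-- The family has the form `A + cos k • B + sin k • D`. Its values at `0`, `π / 2` and `π`
determine the three operators, `D` being `hamiltonianDeriv`, so the Taylor remainder is exact. -/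
theorem hamiltonianI_expansion (p : HoppingParameters) (k : ℝ) (u : EdgeSpace) :
    hamiltonianI p k u - hamiltonianI p 0 u - (k : ℂ) • hamiltonianDeriv p u =
      ((Real.sin k - k : ℝ) : ℂ) • hamiltonianDeriv p u +
        (((1 - Real.cos k) / 2 : ℝ) : ℂ) • (hamiltonianI p Real.pi - hamiltonianI p 0) u := by
  refine lp.ext (funext fun n => ?_)
  change hamActionI p k u n - hamActionI p 0 u n - (k : ℂ) • hamiltonianDeriv p u n =
    ((Real.sin k - k : ℝ) : ℂ) • hamiltonianDeriv p u n +
      (((1 - Real.cos k) / 2 : ℝ) : ℂ) • (hamActionI p Real.pi u n - hamActionI p 0 u n)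
  rw [hamiltonianDeriv_apply]
  ext j
  fin_cases j <;> simp [hamActionI, phase_eq] <;> ring

theorem hamiltonianI_taylor (p : HoppingParameters) (k : ℝ) (u : EdgeSpace) (hk : |k| ≤ 1) :
    ‖hamiltonianI p k u - hamiltonianI p 0 u - (k : ℂ) • hamiltonianDeriv p u‖ ≤
      (‖hamiltonianDeriv p‖ + ‖hamiltonianI p Real.pi - hamiltonianI p 0‖) * k ^ 2 * ‖u‖ := by
  rw [hamiltonianI_expansion]
  have hk0 := abs_nonneg k
  have hsin : |Real.sin k - k| ≤ k ^ 2 := by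
    have h1 := Real.sin_bound hk
    have h2 : |Real.sin k - k| ≤ |Real.sin k - (k - k ^ 3 / 6)| + |k ^ 3 / 6| := by
      have := abs_sub (Real.sin k - (k - k ^ 3 / 6)) (k ^ 3 / 6)
      rwa [show Real.sin k - (k - k ^ 3 / 6) - k ^ 3 / 6 = Real.sin k - k by ring] at this
    have h3 : |k ^ 3 / 6| = |k| ^ 3 / 6 := by rw [abs_div, abs_pow]; norm_num
    have h4 : |k| ^ 3 ≤ |k| ^ 2 := pow_le_pow_of_le_one hk0 hk (by norm_num)
    have h5 : |k| ^ 5 ≤ |k| ^ 2 := pow_le_pow_of_le_one hk0 hk (by norm_num)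
    rw [← sq_abs]
    have := sq_nonneg |k|
    linarith
  have hcos : |(1 - Real.cos k) / 2| ≤ k ^ 2 := by
    rw [abs_of_nonneg (by linarith [Real.cos_le_one k])]
    nlinarith [Real.one_sub_sq_div_two_le_cos (x := k), sq_nonneg k]
  refine (norm_add_le _ _).trans ?_
  rw [norm_smul, norm_smul, Complex.norm_real, Complex.norm_real, Real.norm_eq_abs,
    Real.norm_eq_abs]
  have h1 := mul_le_mul hsin ((hamiltonianDeriv p).le_opNorm u) (norm_nonneg _) (sq_nonneg k)
  have h2 := mul_le_mul hcos ((hamiltonianI p Real.pi - hamiltonianI p 0).le_opNorm u)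
    (norm_nonneg _) (sq_nonneg k)
  linarith

end EdgeOperators

/-! ### Coercivity away from the interface -/

section EdgeEstimates

local notation "Cell" => EuclideanSpace ℂ (Fin 6)

/-- The coefficients of the adjugate of the bulk symbol that multiply the cell to the left. -/
noncomputable def adjugateLeft (b d : ℂ) : Cell →ₗ[ℂ] Cell where
  toFun f := !₂[b * d * f 4 - d ^ 2 * f 5, b * d * f 5, 0, b * d * f 1 - d ^ 2 * f 2, b * d * f 2, 0]
  map_add' x y := by ext j; fin_cases j <;> simp <;> ring
  map_smul' r x := by ext j; fin_cases j <;> simp <;> ring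

/-- The coefficients of the adjugate of the bulk symbol that multiply the cell itself. -/
noncomputable def adjugateCenter (b d : ℂ) : Cell →ₗ[ℂ] Cell where
  toFun f := !₂[(d * b - b ^ 2) * f 3 - b ^ 2 * f 4 + b ^ 2 * f 5,
    -b ^ 2 * f 3 + (b ^ 2 - d ^ 2) * f 4 - b ^ 2 * f 5,
    b ^ 2 * f 3 - b ^ 2 * f 4 + (b * d - b ^ 2) * f 5,
    (d * b - b ^ 2) * f 0 - b ^ 2 * f 1 + b ^ 2 * f 2,
    -b ^ 2 * f 0 + (b ^ 2 - d ^ 2) * f 1 - b ^ 2 * f 2,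
    b ^ 2 * f 0 - b ^ 2 * f 1 + (b * d - b ^ 2) * f 2]
  map_add' x y := by ext j; fin_cases j <;> simp <;> ring
  map_smul' r x := by ext j; fin_cases j <;> simp <;> ring

/-- The coefficients of the adjugate of the bulk symbol that multiply the cell to the right. -/
noncomputable def adjugateRight (b d : ℂ) : Cell →ₗ[ℂ] Cell where
  toFun f := !₂[0, b * d * f 3, -d ^ 2 * f 3 + b * d * f 4, 0, b * d * f 0, -d ^ 2 * f 0 + b * d * f 1]
  map_add' x y := by ext j; fin_cases j <;> simp <;> ring
  map_smul' r x := by ext j; fin_cases j <;> simp <;> ring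

/-- In the bulk, the adjugate symbol turns the Hamiltonian at `k = 0` into a scalar second-order
difference operator. -/
theorem adjugate_hamActionI (p : HoppingParameters) (u : ℤ → Cell) (n : ℤ) {b d : ℝ}
    (hb : p.bI n = b) (hb' : p.bI (n - 1) = b) (hb'' : p.bI (n + 1) = b)
    (hd : p.dI n = d) (hd' : p.dI (n - 1) = d) (hd'' : p.dI (n + 1) = d)
    (hc : p.cI n = d) (hc' : p.cI (n - 1) = d) :
    ((2 * b ^ 3 + d ^ 3 - b ^ 2 * d : ℝ) : ℂ) • u n =
      ((b ^ 2 * d : ℝ) : ℂ) • (u (n + 1) + u (n - 1)) +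
      (adjugateLeft b d (hamActionI p 0 u (n - 1)) + adjugateCenter b d (hamActionI p 0 u n) +
        adjugateRight b d (hamActionI p 0 u (n + 1))) := by
  -- The left and right adjugate terms do not read the components of the action at `n - 1` and `n +
  -- 1` that contain `c (n - 2)` and `c (n + 1)`. Hence the identity holds right up to the cells
  -- next to the interface, whatever `c` is.
  ext j
  fin_cases j <;>
    simp [hamActionI, adjugateLeft, adjugateCenter, adjugateRight, phase, hb, hb', hb'', hd, hd',
      hd'', hc, hc'] <;> ring

theorem exists_cell_bound {b d : ℝ} (hb : 0 < b) (hd : 0 < d) (hne : d ≠ b) :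
    ∃ ρ K : ℝ, 0 ≤ ρ ∧ ρ < 1 / 2 ∧ 0 ≤ K ∧ ∀ (p : HoppingParameters) (u : ℤ → Cell) (n : ℤ),
      p.bI n = b → p.bI (n - 1) = b → p.bI (n + 1) = b → p.dI n = d → p.dI (n - 1) = d →
      p.dI (n + 1) = d → p.cI n = d → p.cI (n - 1) = d →
      ‖u n‖ ≤ ρ * (‖u (n + 1)‖ + ‖u (n - 1)‖) + K * (‖hamActionI p 0 u (n - 1)‖ +
        ‖hamActionI p 0 u n‖ + ‖hamActionI p 0 u (n + 1)‖) := by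
  set κ := 2 * b ^ 3 + d ^ 3 - b ^ 2 * d with hκ
  set β := b ^ 2 * d with hβ
  have hβ0 : 0 < β := by positivity
  have hκβ : 2 * β < κ := by
    -- This is the bulk gap: it closes exactly when the two hoppings agree.
    have : κ - 2 * β = (d - b) ^ 2 * (d + 2 * b) := by rw [hκ, hβ]; ring
    have h2 : 0 < (d - b) ^ 2 * (d + 2 * b) :=
      mul_pos (sq_pos_of_ne_zero (sub_ne_zero.mpr hne)) (by positivity)
    linarith
  have hκ0 : 0 < κ := by linarith
  set N := ‖(adjugateLeft b d).toContinuousLinearMap‖ +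
    ‖(adjugateCenter b d).toContinuousLinearMap‖ +
    ‖(adjugateRight b d).toContinuousLinearMap‖ with hN
  refine ⟨β / κ, N / κ, by positivity, ?_, by positivity, ?_⟩
  · rw [div_lt_iff₀ hκ0]; linarith
  intro p u n h1 h2 h3 h4 h5 h6 h7 h8
  have hid := adjugate_hamActionI p u n h1 h2 h3 h4 h5 h6 h7 h8
  have e1 : ∀ f, ‖adjugateLeft b d f‖ ≤ ‖(adjugateLeft b d).toContinuousLinearMap‖ * ‖f‖ :=
    fun f => (adjugateLeft b d).toContinuousLinearMap.le_opNorm f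
  have e2 : ∀ f, ‖adjugateCenter b d f‖ ≤ ‖(adjugateCenter b d).toContinuousLinearMap‖ * ‖f‖ :=
    fun f => (adjugateCenter b d).toContinuousLinearMap.le_opNorm f
  have e3 : ∀ f, ‖adjugateRight b d f‖ ≤ ‖(adjugateRight b d).toContinuousLinearMap‖ * ‖f‖ :=
    fun f => (adjugateRight b d).toContinuousLinearMap.le_opNorm f
  have hle : κ * ‖u n‖ ≤ β * (‖u (n + 1)‖ + ‖u (n - 1)‖) + N * (‖hamActionI p 0 u (n - 1)‖ +
        ‖hamActionI p 0 u n‖ + ‖hamActionI p 0 u (n + 1)‖) := by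
    have t1 : κ * ‖u n‖ = ‖(κ : ℂ) • u n‖ := by
      rw [norm_smul, Complex.norm_real, Real.norm_of_nonneg hκ0.le]
    rw [t1, hid]
    refine (norm_add_le _ _).trans (add_le_add ?_ ?_)
    · rw [norm_smul, Complex.norm_real, Real.norm_of_nonneg hβ0.le]
      gcongr
      exact norm_add_le _ _
    · refine norm_add₃_le.trans ?_
      have f1 := e1 (hamActionI p 0 u (n - 1))
      have f2 := e2 (hamActionI p 0 u n)
      have f3 := e3 (hamActionI p 0 u (n + 1))
      have g1 := norm_nonneg (hamActionI p 0 u (n - 1))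
      have g2 := norm_nonneg (hamActionI p 0 u n)
      have g3 := norm_nonneg (hamActionI p 0 u (n + 1))
      have k1 := norm_nonneg (adjugateLeft b d).toContinuousLinearMap
      have k2 := norm_nonneg (adjugateCenter b d).toContinuousLinearMap
      have k3 := norm_nonneg (adjugateRight b d).toContinuousLinearMap
      rw [hN]
      nlinarith [mul_nonneg k1 g2, mul_nonneg k1 g3, mul_nonneg k2 g1, mul_nonneg k2 g3,
        mul_nonneg k3 g1, mul_nonneg k3 g2]
  have : ‖u n‖ ≤ (β * (‖u (n + 1)‖ + ‖u (n - 1)‖) + N * (‖hamActionI p 0 u (n - 1)‖ +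
        ‖hamActionI p 0 u n‖ + ‖hamActionI p 0 u (n + 1)‖)) / κ := by
    rw [le_div_iff₀ hκ0]; linarith
  refine this.trans (le_of_eq ?_)
  ring

/-- A square-summable sequence that is a strict subsolution of a second-order difference inequality
is controlled by the inhomogeneity. -/
theorem sum_sq_le_of_subsolution {α h : ℤ → ℝ} {A B ρ : ℝ} (hα : HasSum (fun n => α n ^ 2) A)
    (hh : HasSum (fun n => h n ^ 2) B) (hα0 : ∀ n, 0 ≤ α n) (hρ0 : 0 ≤ ρ) (hρ : ρ < 1 / 2)
    (hle : ∀ n, α n ≤ ρ * (α (n + 1) + α (n - 1)) + h n) : (1 - 2 * ρ) ^ 2 * A ≤ B := by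
  set t := 1 - 2 * ρ with ht
  have ht0 : 0 < t := by linarith
  have h1 : HasSum (fun n => α (n - 1) ^ 2 + α n ^ 2 + α (n + 1) ^ 2) (3 * A) :=
    hasSum_three_shifts (f := fun n => α n ^ 2) hα
  have hR := (((hα.mul_left (ρ / 2 + t / 2)).add (h1.mul_left (ρ / 2)))).add
    (hh.mul_left (1 / (2 * t)))
  have hmain : A ≤ (ρ / 2 + t / 2) * A + ρ / 2 * (3 * A) + 1 / (2 * t) * B := by
    refine hasSum_le (fun n => ?_) hα hR
    have e1 := mul_le_mul_of_nonneg_left (hle n) (hα0 n)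
    -- Young's inequality weighted by `t`, so that only half of the available margin `t A` is spent
    -- on the inhomogeneity.
    have e2 : α n * h n ≤ t / 2 * α n ^ 2 + 1 / (2 * t) * h n ^ 2 := by
      have : t / 2 * α n ^ 2 + 1 / (2 * t) * h n ^ 2 - α n * h n =
          1 / (2 * t) * (t * α n - h n) ^ 2 := by field_simp; ring
      have h3 : 0 ≤ 1 / (2 * t) * (t * α n - h n) ^ 2 := by positivity
      linarith
    have e3 : ρ * (α n * α (n + 1)) ≤ ρ * ((α n ^ 2 + α (n + 1) ^ 2) / 2) :=
      mul_le_mul_of_nonneg_left (by nlinarith [sq_nonneg (α n - α (n + 1))]) hρ0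
    have e4 : ρ * (α n * α (n - 1)) ≤ ρ * ((α n ^ 2 + α (n - 1) ^ 2) / 2) :=
      mul_le_mul_of_nonneg_left (by nlinarith [sq_nonneg (α n - α (n - 1))]) hρ0
    linarith
  have h4 : t * (t * A) ≤ t * (1 / t * B) := by
    refine mul_le_mul_of_nonneg_left ?_ ht0.le
    have h5 : 1 / (2 * t) * B = 1 / 2 * (1 / t * B) := by field_simp
    have h6 : t * A = A - 2 * (ρ * A) := by rw [ht]; ring
    linarith
  have h5 : t * (1 / t * B) = B := by field_simp
  linarith

/-- The two cells adjacent to the interface. -/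
noncomputable def interfaceCells : EdgeSpace →L[ℂ] Cell × Cell :=
  (lp.evalCLM ℂ (fun _ : ℤ => Cell) 2 (-1)).prod (lp.evalCLM ℂ (fun _ : ℤ => Cell) 2 0)

/-- For gapped bulk materials the Hamiltonian at `k = 0` is bounded below up to finite rank. -/
theorem exists_bounded_below_interface (p : HoppingParameters) (hp : p.Positive)
    (hplus : p.deltaPlus ≠ 0) (hminus : p.deltaMinus ≠ 0) :
    ∃ C : ℝ, ∀ u : EdgeSpace, ‖u‖ ≤ C * (‖hamiltonianI p 0 u‖ + ‖interfaceCells u‖) := by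
  obtain ⟨ρ₁, K₁, hρ₁, hρ₁', hK₁, h₁⟩ := exists_cell_bound hp.bPlus_pos hp.interPlus_pos
    (by simpa using hplus)
  obtain ⟨ρ₂, K₂, hρ₂, hρ₂', hK₂, h₂⟩ := exists_cell_bound hp.bMinus_pos hp.interMinus_pos
    (by simpa using hminus)
  set ρ := max ρ₁ ρ₂ with hρdef
  set K := max K₁ K₂ with hKdef
  have hρ0 : 0 ≤ ρ := hρ₁.trans (le_max_left _ _)
  have hρ : ρ < 1 / 2 := max_lt hρ₁' hρ₂'
  have hK : 0 ≤ K := hK₁.trans (le_max_left _ _)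
  set t := 1 - 2 * ρ with ht
  have ht0 : 0 < t := by linarith
  refine ⟨(4 * K + 4) / t, fun u => ?_⟩
  set f := hamiltonianI p 0 u with hf
  -- Only at these two cells does the bulk identity mix both materials; there `χ` makes the
  -- inequality trivial.
  let s : Finset ℤ := {-1, 0}
  let χ : ℤ → ℝ := fun n => if n ∈ s then ‖u n‖ else 0
  let h : ℤ → ℝ := fun n => K * (‖f (n - 1)‖ + ‖f n‖ + ‖f (n + 1)‖) + χ n
  have hle : ∀ n, ‖u n‖ ≤ ρ * (‖u (n + 1)‖ + ‖u (n - 1)‖) + h n := by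
    intro n
    have hS : 0 ≤ ‖f (n - 1)‖ + ‖f n‖ + ‖f (n + 1)‖ := by positivity
    have hU : 0 ≤ ‖u (n + 1)‖ + ‖u (n - 1)‖ := by positivity
    by_cases hn : n ∈ s
    · have hχn : χ n = ‖u n‖ := if_pos hn
      have := mul_nonneg hρ0 hU
      have := mul_nonneg hK hS
      simp only [h, hχn]
      linarith
    · have hχn : χ n = 0 := if_neg hn
      simp only [s, Finset.mem_insert, Finset.mem_singleton, not_or] at hn
      simp only [h, hχn, add_zero]
      rcases lt_or_ge n 0 with hneg | hpos
      · have hn2 : n ≤ -2 := by omega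
        refine (h₂ p u n ?_ ?_ ?_ ?_ ?_ ?_ ?_ ?_).trans (add_le_add
          (mul_le_mul_of_nonneg_right (le_max_right _ _) hU)
          (mul_le_mul_of_nonneg_right (le_max_right _ _) hS)) <;>
        simp only [HoppingParameters.bI, HoppingParameters.dI, HoppingParameters.cI,
          HoppingParameters.aI] <;> split_ifs <;> first | rfl | omega
      · have hn2 : 1 ≤ n := by omega
        refine (h₁ p u n ?_ ?_ ?_ ?_ ?_ ?_ ?_ ?_).trans (add_le_add
          (mul_le_mul_of_nonneg_right (le_max_left _ _) hU)
          (mul_le_mul_of_nonneg_right (le_max_left _ _) hS)) <;>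
        simp only [HoppingParameters.bI, HoppingParameters.dI, HoppingParameters.cI,
          HoppingParameters.aI] <;> split_ifs <;> first | rfl | omega
  have hχsum : HasSum (fun n => χ n ^ 2) (‖u (-1)‖ ^ 2 + ‖u 0‖ ^ 2) := by
    have : HasSum (fun n => χ n ^ 2) (∑ n ∈ s, χ n ^ 2) :=
      hasSum_sum_of_ne_finset_zero fun n hn => by simp [χ, hn]
    simpa [s, χ] using this
  have hbig := (((hasSum_norm_sq_shifts f).mul_left (K ^ 2)).add hχsum).mul_left 4
  have hhle : ∀ n, h n ^ 2 ≤
      4 * (K ^ 2 * (‖f (n - 1)‖ ^ 2 + ‖f n‖ ^ 2 + ‖f (n + 1)‖ ^ 2) + χ n ^ 2) := by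
    intro n
    have key : ∀ x y z w : ℝ, (x + y + z + w) ^ 2 ≤ 4 * (x ^ 2 + y ^ 2 + z ^ 2 + w ^ 2) := by
      intro x y z w
      nlinarith [sq_nonneg (x - y), sq_nonneg (x - z), sq_nonneg (x - w), sq_nonneg (y - z),
        sq_nonneg (y - w), sq_nonneg (z - w)]
    have := key (K * ‖f (n - 1)‖) (K * ‖f n‖) (K * ‖f (n + 1)‖) (χ n)
    calc h n ^ 2 = (K * ‖f (n - 1)‖ + K * ‖f n‖ + K * ‖f (n + 1)‖ + χ n) ^ 2 := by
          simp only [h]; ring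
      _ ≤ _ := this
      _ = _ := by ring
  have hhs : Summable fun n => h n ^ 2 :=
    Summable.of_nonneg_of_le (fun _ => sq_nonneg _) hhle hbig.summable
  have hfin := sum_sq_le_of_subsolution (α := fun n => ‖u n‖) (hasSum_norm_sq u) hhs.hasSum
    (fun n => norm_nonneg _) hρ0 hρ hle
  have hB := hasSum_le hhle hhs.hasSum hbig
  rw [← ht] at hfin
  have hF1 : ‖u (-1)‖ ≤ ‖interfaceCells u‖ := norm_fst_le (interfaceCells u)
  have hF2 : ‖u 0‖ ≤ ‖interfaceCells u‖ := norm_snd_le (interfaceCells u)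
  have hF3 := pow_le_pow_left₀ (norm_nonneg _) hF1 2
  have hF4 := pow_le_pow_left₀ (norm_nonneg _) hF2 2
  have hsq : (t * ‖u‖) ^ 2 ≤ ((4 * K + 4) * (‖f‖ + ‖interfaceCells u‖)) ^ 2 := by
    rw [mul_pow]
    refine hfin.trans (hB.trans ?_)
    have a1 := norm_nonneg f
    have a2 := norm_nonneg (interfaceCells u)
    have s1 : 4 * (K ^ 2 * (3 * ‖f‖ ^ 2) + (‖u (-1)‖ ^ 2 + ‖u 0‖ ^ 2)) ≤
        16 * (K * ‖f‖) ^ 2 + 16 * ‖interfaceCells u‖ ^ 2 := by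
      nlinarith [sq_nonneg (K * ‖f‖), sq_nonneg ‖interfaceCells u‖]
    have s2 : 16 * (K * ‖f‖) ^ 2 + 16 * ‖interfaceCells u‖ ^ 2 ≤
        (4 * (K * ‖f‖) + 4 * ‖interfaceCells u‖) ^ 2 := by
      nlinarith [mul_nonneg (mul_nonneg hK a1) a2]
    refine s1.trans (s2.trans (pow_le_pow_left₀ (by positivity) ?_ 2))
    nlinarith [mul_nonneg hK a2]
  have hfinal := abs_le_of_sq_le_sq' hsq (by positivity) |>.2
  rw [div_mul_eq_mul_div, le_div_iff₀ ht0]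
  linarith

/-! ### Zero modes and the gapless case -/

/-- The zero-energy equations on one sublattice at `k = 0`. -/
structure ZeroMode (p : HoppingParameters) (x y z : ℤ → ℂ) : Prop where
  left : ∀ n, (p.bI n : ℂ) * x n + p.bI n * y n + p.cI (n - 1) * z (n - 1) = 0
  center : ∀ n, (p.bI n : ℂ) * x n + p.dI n * y n + p.bI n * z n = 0
  right : ∀ n, (p.cI n : ℂ) * x (n + 1) + p.bI n * y n + p.bI n * z n = 0

theorem HoppingParameters.Positive.bI_pos {p : HoppingParameters} (hp : p.Positive) (n : ℤ) :
    0 < p.bI n := by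
  unfold HoppingParameters.bI
  split_ifs
  exacts [hp.bPlus_pos, hp.bMinus_pos]

theorem HoppingParameters.Positive.dI_pos {p : HoppingParameters} (hp : p.Positive) (n : ℤ) :
    0 < p.dI n := by
  unfold HoppingParameters.dI
  split_ifs
  exacts [hp.interPlus_pos, hp.interMinus_pos]

theorem HoppingParameters.Positive.cI_pos {p : HoppingParameters} (hp : p.Positive) (n : ℤ) :
    0 < p.cI n := by
  unfold HoppingParameters.cI HoppingParameters.aI
  split_ifs
  exacts [hp.interPlus_pos, hp.c_pos, hp.interMinus_pos]

namespace ZeroMode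

variable {p : HoppingParameters} {x y z : ℤ → ℂ}

/-- A zero mode whose Cauchy data vanish at one bond vanishes identically. -/
theorem eq_zero_of_bond (hp : p.Positive) (h : ZeroMode p x y z) {m : ℤ} (hx : x (m + 1) = 0)
    (hz : z m = 0) : x = 0 ∧ y = 0 ∧ z = 0 := by
  have hb : ∀ n, (p.bI n : ℂ) ≠ 0 := fun n => Complex.ofReal_ne_zero.mpr (hp.bI_pos n).ne'
  have hc : ∀ n, (p.cI n : ℂ) ≠ 0 := fun n => Complex.ofReal_ne_zero.mpr (hp.cI_pos n).ne'
  have hy : ∀ n, x (n + 1) = 0 → z n = 0 → y n = 0 := by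
    intro n h1 h2
    have := h.right n
    simpa [h1, h2, hb n] using this
  have hall : ∀ n, x (n + 1) = 0 ∧ z n = 0 := by
    intro n
    induction n using Int.inductionOn' (b := m) with
    | zero => exact ⟨hx, hz⟩
    | succ n _ ih =>
      have h1 : y (n + 1) = 0 := by
        have := h.left (n + 1)
        simpa [ih.1, ih.2, hb (n + 1)] using this
      have h2 : z (n + 1) = 0 := by
        have := h.center (n + 1)
        simpa [ih.1, h1, hb (n + 1)] using this
      refine ⟨?_, h2⟩
      have := h.right (n + 1)
      simpa [h1, h2, hc (n + 1)] using this
    | pred n _ ih =>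
      have h1 := hy n ih.1 ih.2
      have h2 : x n = 0 := by
        have := h.center n
        simpa [ih.2, h1, hb n] using this
      refine ⟨by rwa [sub_add_cancel], ?_⟩
      have := h.left n
      simpa [h1, h2, hc (n - 1)] using this
  refine ⟨funext fun n => ?_, funext fun n => hy n (hall n).1 (hall n).2,
    funext fun n => (hall n).2⟩
  have := (hall (n - 1)).1
  rwa [sub_add_cancel] at this

theorem eq_zero_of_constant_along {f : ℤ → ℂ} (hf : Tendsto f cofinite (𝓝 0)) {s : ℕ → ℤ}
    (hs : Function.Injective s) {w : ℂ} (hw : ∀ m, f (s m) = w) : w = 0 := by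
  have h1 : Tendsto (fun m => f (s m)) cofinite (𝓝 0) := hf.comp hs.tendsto_cofinite
  simp only [hw] at h1
  exact tendsto_nhds_unique tendsto_const_nhds h1

/-- With equal hoppings the left, center and right equations share their coefficients, and
subtracting the center one leaves a single difference of neighbouring values. -/
theorem succ_eq_of_equal_hopping (hp : p.Positive) (h : ZeroMode p x y z) {n : ℤ}
    (hd : p.dI n = p.bI n) : (p.cI n = p.bI n → x (n + 1) = x n) ∧
      (p.cI (n - 1) = p.bI n → z (n - 1) = z n) := by
  have hb : (p.bI n : ℂ) ≠ 0 := Complex.ofReal_ne_zero.mpr (hp.bI_pos n).ne'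
  have h1 := h.left n
  have h2 := h.center n
  have h3 := h.right n
  rw [hd] at h2
  refine ⟨fun hc => ?_, fun hc => ?_⟩
  · rw [hc] at h3
    exact mul_left_cancel₀ hb (by linear_combination h3 - h2)
  · rw [hc] at h1
    exact mul_left_cancel₀ hb (by linear_combination h1 - h2)

/-- If one of the bulk materials is gapless there is no decaying zero mode. -/
theorem eq_zero_of_gapless (hp : p.Positive) (h : ZeroMode p x y z)
    (hx : Tendsto x cofinite (𝓝 0)) (hz : Tendsto z cofinite (𝓝 0))
    (hδ : p.deltaPlus = 0 ∨ p.deltaMinus = 0) : x = 0 ∧ y = 0 ∧ z = 0 := by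
  rcases hδ with hδ | hδ
  · have hconst : ∀ m : ℕ, x ((m : ℤ) + 1) = x 1 ∧ z m = z 0 := by
      intro m
      induction m with
      | zero => simp
      | succ m ih =>
        have hs := h.succ_eq_of_equal_hopping hp (n := (m : ℤ) + 1) (by
          simp only [HoppingParameters.dI, HoppingParameters.bI, hδ]
          split_ifs <;> first | omega | simp)
        have h1 := hs.1 (by
          simp only [HoppingParameters.cI, HoppingParameters.aI, HoppingParameters.bI, hδ]
          split_ifs <;> first | omega | simp)
        have h2 := hs.2 (by
          simp only [HoppingParameters.cI, HoppingParameters.aI, HoppingParameters.bI, hδ]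
          split_ifs <;> first | omega | simp)
        rw [add_sub_cancel_right] at h2
        push_cast
        exact ⟨h1.trans ih.1, h2.symm.trans ih.2⟩
    exact h.eq_zero_of_bond hp (m := 0)
      (eq_zero_of_constant_along hx (s := fun m => (m : ℤ) + 1)
        (fun a b hab => by simpa using hab) fun m => (hconst m).1)
      (eq_zero_of_constant_along hz (s := fun m => (m : ℤ)) Nat.cast_injective
        fun m => (hconst m).2)
  · have hconst : ∀ m : ℕ, x (-1 - (m : ℤ)) = x (-1) ∧ z (-2 - (m : ℤ)) = z (-2) := by
      intro m
      induction m with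
      | zero => simp
      | succ m ih =>
        have hs := h.succ_eq_of_equal_hopping hp (n := -2 - (m : ℤ)) (by
          simp only [HoppingParameters.dI, HoppingParameters.bI, hδ]
          split_ifs <;> first | omega | simp)
        have h1 := hs.1 (by
          simp only [HoppingParameters.cI, HoppingParameters.aI, HoppingParameters.bI, hδ]
          split_ifs <;> first | omega | simp)
        have h2 := hs.2 (by
          simp only [HoppingParameters.cI, HoppingParameters.aI, HoppingParameters.bI, hδ]
          split_ifs <;> first | omega | simp)
        rw [show (-2 - (m : ℤ)) + 1 = -1 - m by ring] at h1
        push_cast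
        rw [show (-1 - ((m : ℤ) + 1)) = -2 - m by ring, ← h1,
          show (-2 - ((m : ℤ) + 1)) = -2 - m - 1 by ring, h2]
        exact ih
    exact h.eq_zero_of_bond hp (m := -2)
      (eq_zero_of_constant_along hx (s := fun m => -1 - (m : ℤ))
        (fun a b hab => by simpa using hab) fun m => (hconst m).1)
      (eq_zero_of_constant_along hz (s := fun m => -2 - (m : ℤ))
        (fun a b hab => by simpa using hab) fun m => (hconst m).2)

end ZeroMode

theorem tendsto_coord (u : EdgeSpace) (j : Fin 6) :
    Tendsto (fun n : ℤ => u n j) cofinite (𝓝 0) := by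
  have h1 : Tendsto (fun n : ℤ => ‖u n‖) cofinite (𝓝 0) := by
    have := (summable_norm_sq u).tendsto_cofinite_zero.sqrt
    simpa using this
  exact squeeze_zero_norm (fun n => PiLp.norm_apply_le (u n) j) h1

theorem zeroMode_of_hamiltonianI_eq_zero {p : HoppingParameters} {u : EdgeSpace}
    (hu : hamiltonianI p 0 u = 0) :
    ZeroMode p (fun n => u n 0) (fun n => u n 1) (fun n => u n 2) ∧
      ZeroMode p (fun n => u n 3) (fun n => u n 4) (fun n => u n 5) := by
  have hn : ∀ n j, hamActionI p 0 u n j = 0 := fun n j => by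
    rw [← hamiltonianI_apply, hu]; rfl
  have hph : phase 0 = 1 := by simp [phase]
  refine ⟨⟨fun n => ?_, fun n => ?_, fun n => ?_⟩, ⟨fun n => ?_, fun n => ?_, fun n => ?_⟩⟩
  · have := hn n 3
    simp only [hamActionI, PiLp.toLp_apply, Matrix.cons_val] at this
    linear_combination -this
  · have := hn n 4
    simp only [hamActionI, PiLp.toLp_apply, Matrix.cons_val, neg_zero, hph] at this
    linear_combination -this
  · have := hn n 5
    simp only [hamActionI, PiLp.toLp_apply, Matrix.cons_val, hph] at this
    linear_combination -this
  · have := hn n 0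
    simp only [hamActionI, PiLp.toLp_apply, Matrix.cons_val, neg_zero, hph] at this
    linear_combination -this
  · have := hn n 1
    simp only [hamActionI, PiLp.toLp_apply, Matrix.cons_val, hph] at this
    linear_combination -this
  · have := hn n 2
    simp only [hamActionI, PiLp.toLp_apply, Matrix.cons_val] at this
    linear_combination -this

theorem eq_zero_of_gapless {p : HoppingParameters} (hp : p.Positive) {u : EdgeSpace}
    (hu : hamiltonianI p 0 u = 0) (hδ : p.deltaPlus = 0 ∨ p.deltaMinus = 0) : u = 0 := by
  obtain ⟨h1, h2⟩ := zeroMode_of_hamiltonianI_eq_zero hu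
  obtain ⟨a0, a1, a2⟩ := h1.eq_zero_of_gapless hp (tendsto_coord u 0) (tendsto_coord u 2) hδ
  obtain ⟨a3, a4, a5⟩ := h2.eq_zero_of_gapless hp (tendsto_coord u 3) (tendsto_coord u 5) hδ
  refine lp.ext (funext fun n => ?_)
  ext j
  fin_cases j
  exacts [congrFun a0 n, congrFun a1 n, congrFun a2 n, congrFun a3 n, congrFun a4 n, congrFun a5 n]

end EdgeEstimates

/-! ### The two zero modes and their coupling -/

section EdgeCrossing

theorem coord_eq_zero_of_chiral {φ : EdgeSpace} (h : cellwise chiralCell φ = φ) (n : ℤ) :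
    φ n 3 = 0 ∧ φ n 4 = 0 ∧ φ n 5 = 0 := by
  have hn : ∀ j, chiralCell (φ n) j = φ n j := fun j => by
    rw [← cellwise_apply, h]
  have h3 := hn 3
  have h4 := hn 4
  have h5 := hn 5
  simp only [chiralCell_apply, PiLp.toLp_apply, Matrix.cons_val] at h3 h4 h5
  exact ⟨self_eq_neg.mp h3.symm, self_eq_neg.mp h4.symm, self_eq_neg.mp h5.symm⟩

/-- The kernel at `k = 0` contains a unit vector supported on the first sublattice. -/
theorem exists_chiral_zeroMode {p : HoppingParameters} {ψ : EdgeSpace}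
    (hψ : hamiltonianI p 0 ψ = 0) (hψ0 : ψ ≠ 0) :
    ∃ φ : EdgeSpace, ‖φ‖ = 1 ∧ hamiltonianI p 0 φ = 0 ∧ cellwise chiralCell φ = φ := by
  obtain ⟨φ, hφ0, hφ, hφc⟩ : ∃ φ : EdgeSpace, φ ≠ 0 ∧ hamiltonianI p 0 φ = 0 ∧
      cellwise chiralCell φ = φ := by
    -- The sum is twice the part of `ψ` on the first sublattice. If it vanishes, `ψ` lives on the
    -- second and is moved over by the swap.
    by_cases h : ψ + cellwise chiralCell ψ = 0
    · have h1 : cellwise chiralCell ψ = -ψ := (neg_eq_of_add_eq_zero_right h).symm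
      refine ⟨cellwise swapCell ψ, fun h0 => hψ0 ?_, ?_, ?_⟩
      · rw [← cellwise_swapCell_involutive ψ, h0, map_zero]
      · rw [hamiltonianI_zero_swap, hψ, map_zero]
      · rw [cellwise_chiral_swap, h1, map_neg, neg_neg]
    · refine ⟨_, h, ?_, ?_⟩
      · rw [map_add, hamiltonianI_chiral, hψ, map_zero, neg_zero, add_zero]
      · rw [map_add, cellwise_chiralCell_involutive, add_comm]
  have hn : 0 < ‖φ‖ := norm_pos_iff.mpr hφ0
  refine ⟨((‖φ‖ : ℂ)⁻¹) • φ, ?_, ?_, ?_⟩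
  · rw [norm_smul, norm_inv, Complex.norm_real, norm_norm, inv_mul_cancel₀ hn.ne']
  · rw [map_smul, hφ, smul_zero]
  · rw [map_smul, hφc]

theorem inner_eq_zero_of_cells {u v : EdgeSpace} (h : ∀ n, inner ℂ (u n) (v n) = 0) :
    inner ℂ u v = 0 := by
  have h1 := lp.hasSum_inner (𝕜 := ℂ) u v
  simp only [h] at h1
  exact h1.unique hasSum_zero

theorem inner_swap_eq_zero {φ : EdgeSpace} (h : cellwise chiralCell φ = φ) :
    inner ℂ φ (cellwise swapCell φ) = 0 := by
  refine inner_eq_zero_of_cells fun n => ?_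
  obtain ⟨h3, h4, h5⟩ := coord_eq_zero_of_chiral h n
  rw [PiLp.inner_apply, Fin.sum_univ_six, cellwise_apply]
  simp [swapCell_apply, h3, h4, h5]

theorem inner_deriv_self_eq_zero (p : HoppingParameters) {φ : EdgeSpace}
    (h : cellwise chiralCell φ = φ) : inner ℂ φ (hamiltonianDeriv p φ) = 0 := by
  refine inner_eq_zero_of_cells fun n => ?_
  obtain ⟨h3, h4, h5⟩ := coord_eq_zero_of_chiral h n
  obtain ⟨-, -, h5'⟩ := coord_eq_zero_of_chiral h (n - 1)
  rw [PiLp.inner_apply, Fin.sum_univ_six, hamiltonianDeriv_apply]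
  simp [h3, h4, h5, h5']

theorem inner_deriv_swap_eq_zero (p : HoppingParameters) {φ : EdgeSpace}
    (h : cellwise chiralCell φ = φ) :
    inner ℂ (cellwise swapCell φ) (hamiltonianDeriv p (cellwise swapCell φ)) = 0 := by
  refine inner_eq_zero_of_cells fun n => ?_
  obtain ⟨h3, h4, h5⟩ := coord_eq_zero_of_chiral h n
  obtain ⟨h3', -, -⟩ := coord_eq_zero_of_chiral h (n + 1)
  rw [PiLp.inner_apply, Fin.sum_univ_six, hamiltonianDeriv_apply]
  simp [cellwise_apply, swapCell_apply, h3, h4, h5, h3']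

/-- The derivative of the Hamiltonian couples the two zero modes: twice its matrix element is,
up to the factor `i`, the positive sum of `b (|x|² + |z|²) + d |y|²`. -/
theorem inner_swap_deriv_ne_zero {p : HoppingParameters} (hp : p.Positive) {φ : EdgeSpace}
    (hφ0 : φ ≠ 0) (hφ : hamiltonianI p 0 φ = 0) (h : cellwise chiralCell φ = φ) :
    inner ℂ (cellwise swapCell φ) (hamiltonianDeriv p φ) ≠ 0 := by
  intro hzero
  obtain ⟨hm, -⟩ := zeroMode_of_hamiltonianI_eq_zero hφ
  let q : ℤ → ℂ := fun n => (p.cI n : ℂ) * 1 * (φ (n + 1) 0 * starRingEnd ℂ (φ n 2))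
  have hq : Summable q := summable_bond p 1 φ φ 0 2
  -- The cell contributions to the matrix element divided by `i`; assuming it vanishes, they sum to
  -- zero.
  let t : ℤ → ℂ := fun n => (p.dI n : ℂ) * (φ n 1 * starRingEnd ℂ (φ n 1)) - q n
  have ht : HasSum t 0 := by
    have h1 := (lp.hasSum_inner (𝕜 := ℂ) (cellwise swapCell φ) (hamiltonianDeriv p φ)).mul_left
      (-Complex.I)
    rw [hzero, mul_zero] at h1
    refine (congrArg (HasSum · 0) (funext fun n => ?_)).mpr h1
    obtain ⟨h3, h4, h5⟩ := coord_eq_zero_of_chiral h n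
    rw [PiLp.inner_apply, Fin.sum_univ_six, cellwise_apply, hamiltonianDeriv_apply]
    simp only [t, q, swapCell_apply, RCLike.inner_apply, PiLp.toLp_apply, Matrix.cons_val, h3, h4,
      h5, map_zero, mul_zero, zero_mul, add_zero, zero_add]
    linear_combination ((p.dI n : ℂ) * φ n 1 * starRingEnd ℂ (φ n 1) -
      (p.cI n : ℂ) * φ (n + 1) 0 * starRingEnd ℂ (φ n 2)) * Complex.I_mul_I
  have hqs : HasSum (fun n : ℤ => q (n - 1)) (∑' n, q n) :=
    (Equiv.subRight (1 : ℤ)).hasSum_iff.mpr hq.hasSum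
  -- Adding `q n - q (n - 1)` does not change the sum but shares each bond term equally between its
  -- two cells. The left and right equations then express the bond terms through cell values, and
  -- the center equation removes the mixed products.
  have hs := Complex.hasSum_re (((ht.mul_left 2).add hq.hasSum).sub hqs)
  have hval : ∀ n, (2 * t n + q n - q (n - 1)).re =
      p.bI n * (‖φ n 0‖ ^ 2 + ‖φ n 2‖ ^ 2) + p.dI n * ‖φ n 1‖ ^ 2 := by
    intro n
    have e1 := hm.left n
    have e2 := hm.center n
    have e3 := hm.right n
    simp only [Complex.ext_iff, Complex.add_re, Complex.add_im, Complex.re_ofReal_mul,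
      Complex.im_ofReal_mul, Complex.zero_re, Complex.zero_im] at e1 e2 e3
    simp only [t, q, sub_add_cancel, Complex.sq_norm, Complex.normSq_apply, Complex.add_re,
      Complex.sub_re, mul_one, Complex.mul_re, Complex.mul_im,
      Complex.conj_re, Complex.conj_im, Complex.re_ofNat, Complex.im_ofNat, Complex.ofReal_re,
      Complex.ofReal_im]
    linear_combination (φ n 1).re * e2.1 + (φ n 1).im * e2.2 - (φ n 2).re * e3.1
      - (φ n 2).im * e3.2 - (φ n 0).re * e1.1 - (φ n 0).im * e1.2
  simp only [hval] at hs
  have hnn : ∀ n, 0 ≤ p.bI n * (‖φ n 0‖ ^ 2 + ‖φ n 2‖ ^ 2) + p.dI n * ‖φ n 1‖ ^ 2 := fun n => by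
    have := hp.bI_pos n
    have := hp.dI_pos n
    positivity
  rw [show (2 * 0 + ∑' n, q n - ∑' n, q n : ℂ).re = 0 by simp] at hs
  have hz := (hasSum_zero_iff_of_nonneg hnn).mp hs
  apply hφ0
  refine lp.ext (funext fun n => ?_)
  obtain ⟨h3, h4, h5⟩ := coord_eq_zero_of_chiral h n
  have hzn : p.bI n * (‖φ n 0‖ ^ 2 + ‖φ n 2‖ ^ 2) + p.dI n * ‖φ n 1‖ ^ 2 = 0 := congrFun hz n
  have hb := hp.bI_pos n
  have hd := hp.dI_pos n
  have h012 : φ n 0 = 0 ∧ φ n 1 = 0 ∧ φ n 2 = 0 := by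
    have g0 : 0 ≤ p.bI n * ‖φ n 0‖ ^ 2 := by positivity
    have g1 : 0 ≤ p.dI n * ‖φ n 1‖ ^ 2 := by positivity
    have g2 : 0 ≤ p.bI n * ‖φ n 2‖ ^ 2 := by positivity
    have k0 : p.bI n * ‖φ n 0‖ ^ 2 = 0 := by linarith
    have k1 : p.dI n * ‖φ n 1‖ ^ 2 = 0 := by linarith
    have k2 : p.bI n * ‖φ n 2‖ ^ 2 = 0 := by linarith
    exact ⟨by simpa [hb.ne'] using k0, by simpa [hd.ne'] using k1, by simpa [hb.ne'] using k2⟩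
  ext j
  fin_cases j
  exacts [h012.1, h012.2.1, h012.2.2, h3, h4, h5]

theorem exists_span_of_finrank_eq_two {V : Type*} [AddCommGroup V] [Module ℂ V]
    {S : Submodule ℂ V} (hS : Module.finrank ℂ S = 2) {x y : V} (hx : x ∈ S) (hy : y ∈ S)
    (hxy : LinearIndependent ℂ ![x, y]) {u : V} (hu : u ∈ S) :
    ∃ α β : ℂ, u = α • x + β • y := by
  have : FiniteDimensional ℂ S := Module.finite_of_finrank_pos (by omega)
  have hle : Submodule.span ℂ {x, y} ≤ S := by
    rw [Submodule.span_le]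
    rintro v (rfl | rfl)
    exacts [hx, hy]
  have hrank : Module.finrank ℂ (Submodule.span ℂ {x, y}) = 2 := by
    have := finrank_span_eq_card hxy
    rwa [Matrix.range_cons_cons_empty, Fintype.card_fin] at this
  have heq := Submodule.eq_of_le_of_finrank_eq hle (hrank.trans hS.symm)
  rw [← heq] at hu
  obtain ⟨α, β, h⟩ := Submodule.mem_span_pair.mp hu
  exact ⟨α, β, h.symm⟩

theorem exists_chiralCrossing (p : HoppingParameters) (hp : p.Positive)
    (hzero : Module.finrank ℂ
      (Module.End.eigenspace (hamiltonianI p 0 : EdgeSpace →ₗ[ℂ] EdgeSpace) 0) = 2) :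
    ∃ (φ₁ φ₂ : EdgeSpace) (a : ℂ) (M : ℝ),
      ChiralCrossing (hamiltonianI p) (hamiltonianDeriv p) φ₁ φ₂ a M ∧
        p.deltaPlus ≠ 0 ∧ p.deltaMinus ≠ 0 := by
  have hmem : ∀ u, u ∈ Module.End.eigenspace (hamiltonianI p 0 : EdgeSpace →ₗ[ℂ] EdgeSpace) 0 ↔
      hamiltonianI p 0 u = 0 := fun u => by
    rw [Module.End.mem_eigenspace_iff, zero_smul, ContinuousLinearMap.coe_coe]
  obtain ⟨ψ, hψS, hψ0⟩ := Submodule.exists_mem_ne_zero_of_ne_bot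
    (p := Module.End.eigenspace (hamiltonianI p 0 : EdgeSpace →ₗ[ℂ] EdgeSpace) 0) (by
      intro hbot
      rw [hbot, finrank_bot] at hzero
      omega)
  have hψ := (hmem ψ).mp hψS
  obtain ⟨φ, hφ1, hφ, hφc⟩ := exists_chiral_zeroMode hψ hψ0
  have hφ0 : φ ≠ 0 := by
    rintro rfl
    simp at hφ1
  have hswap : hamiltonianI p 0 (cellwise swapCell φ) = 0 := by
    rw [hamiltonianI_zero_swap, hφ, map_zero]
  have hnswap : ‖cellwise swapCell φ‖ = 1 := (norm_cellwise_swapCell φ).trans hφ1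
  have horth := inner_swap_eq_zero hφc
  have hli : LinearIndependent ℂ ![φ, cellwise swapCell φ] := by
    have : Orthonormal ℂ ![φ, cellwise swapCell φ] := by
      rw [orthonormal_vecCons_iff]
      simp [hφ1, hnswap, horth]
    exact this.linearIndependent
  refine ⟨φ, cellwise swapCell φ, _, _,
    { selfAdjoint := hamiltonianI_isSelfAdjoint p
      selfAdjoint_deriv := hamiltonianDeriv_isSelfAdjoint p
      taylor := hamiltonianI_taylor p
      norm_left := hφ1
      norm_right := hnswap
      orthogonal := horth
      map_left := hφ
      map_right := hswap
      ker_le := fun u hu => exists_span_of_finrank_eq_two hzero ((hmem _).mpr hφ)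
        ((hmem _).mpr hswap) hli ((hmem u).mpr hu)
      inner_left := inner_deriv_self_eq_zero p hφc
      inner_right := inner_deriv_swap_eq_zero p hφc
      inner_cross := rfl
      cross_ne_zero := inner_swap_deriv_ne_zero hp hφ0 hφ hφc
      chiral := hasEigenvalue_neg p }, ?_, ?_⟩
  · exact fun h => hψ0 (eq_zero_of_gapless hp hψ (Or.inl h))
  · exact fun h => hψ0 (eq_zero_of_gapless hp hψ (Or.inr h))

end EdgeCrossing

/-! ### Smooth energy curves through the crossing -/

theorem hasDerivAt_zero_of_abs_sub_le {f : ℝ → ℝ} {m C r : ℝ} (hr : 0 < r)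
    (h : ∀ k, |k| < r → |f k - m * k| ≤ C * k ^ 2) : HasDerivAt f m 0 := by
  have h0 : f 0 = 0 := by simpa using h 0 (by simpa using hr)
  rw [hasDerivAt_iff_isLittleO_nhds_zero]
  have hO : (fun k : ℝ => f (0 + k) - f 0 - k • m) =O[𝓝 0] fun k : ℝ => k ^ 2 := by
    refine IsBigO.of_bound C ?_
    filter_upwards [Metric.ball_mem_nhds (0 : ℝ) hr] with k hk
    have := h k (by simpa using hk)
    rw [zero_add, h0, sub_zero, smul_eq_mul, mul_comm k m, Real.norm_eq_abs, Real.norm_eq_abs,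
      abs_of_nonneg (sq_nonneg k)]
    exact this
  exact hO.trans_isLittleO (isLittleO_pow_id one_lt_two)

theorem mainTheorem3 (p : HoppingParameters) (hp : p.Positive)
    (hzero : Module.finrank ℂ
      (Module.End.eigenspace (hamiltonianI p 0 : EdgeSpace →ₗ[ℂ] EdgeSpace) 0) = 2) :
    ∃ (E₁ : ℝ) (Eminus Eplus : ℝ → ℝ), 0 < E₁ ∧
      -- for small `k`, the point spectrum near zero consists of the two branches
      (∃ η : ℝ, 0 < η ∧ ∃ k₀ : ℝ, 0 < k₀ ∧ ∀ k : ℝ, |k| < k₀ →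
        {E : ℂ | ‖E‖ < η ∧
          Module.End.HasEigenvalue (hamiltonianI p k : EdgeSpace →ₗ[ℂ] EdgeSpace) E}
            = {(Eminus k : ℂ), (Eplus k : ℂ)} ∧
        (k ≠ 0 → Eminus k < Eplus k)) ∧
      -- the asymptotic expansions
      (fun k : ℝ => Eplus k - E₁ * |k|) =O[𝓝 0] (fun k : ℝ => k ^ 2) ∧
      (fun k : ℝ => Eminus k - (-E₁ * |k|)) =O[𝓝 0] (fun k : ℝ => k ^ 2) ∧
      -- the energy curves through the crossing meet at zero energy with slopes `E₁` and `-E₁`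
      Eminus 0 = 0 ∧ Eplus 0 = 0 ∧
      HasDerivAt (fun k : ℝ => if 0 ≤ k then Eplus k else Eminus k) E₁ 0 ∧
      HasDerivAt (fun k : ℝ => if 0 ≤ k then Eminus k else Eplus k) (-E₁) 0 := by

  obtain ⟨φ₁, φ₂, a, M, hcross, hplus, hminus⟩ := exists_chiralCrossing p hp hzero
  obtain ⟨C, hC⟩ := exists_bounded_below_interface p hp hplus hminus
  obtain ⟨η, C', r, e, hη, hr, hk⟩ := hcross.exists_branches interfaceCells hC
  have he0 : e 0 = 0 := by
    have := (hk 0 (by simpa using hr)).2.2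
    simpa using this
  have hball : ∀ᶠ k : ℝ in 𝓝 0, |k| < r := by
    filter_upwards [Metric.ball_mem_nhds (0 : ℝ) hr] with k hkr
    simpa using hkr
  refine ⟨‖a‖, fun k => -e k, e, norm_pos_iff.mpr hcross.cross_ne_zero,
    ⟨η, hη, r, hr, fun k hkr => ⟨(hk k hkr).1, fun hk0 => ?_⟩⟩, ?_, ?_, by simp [he0], he0, ?_, ?_⟩
  · have := (hk k hkr).2.1 hk0
    linarith
  · refine IsBigO.of_bound C' ?_
    filter_upwards [hball] with k hkr
    rw [Real.norm_eq_abs, Real.norm_eq_abs, abs_of_nonneg (sq_nonneg k)]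
    exact (hk k hkr).2.2
  · refine IsBigO.of_bound C' ?_
    filter_upwards [hball] with k hkr
    rw [Real.norm_eq_abs, Real.norm_eq_abs, abs_of_nonneg (sq_nonneg k), ← abs_neg]
    refine le_trans (le_of_eq ?_) (hk k hkr).2.2
    congr 1; ring
  -- Changing branch at `k = 0` replaces `|k|` by `k`: for `k < 0` the value is `-e k`, close to
  -- `-‖a‖ |k| = ‖a‖ k`.
  · refine hasDerivAt_zero_of_abs_sub_le hr (C := C') fun k hkr => ?_
    have h1 := (hk k hkr).2.2
    split_ifs with hk0
    · rwa [abs_of_nonneg hk0] at h1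
    · rw [abs_of_neg (not_le.mp hk0), ← abs_neg] at h1
      refine le_trans (le_of_eq ?_) h1
      congr 1; ring
  · refine hasDerivAt_zero_of_abs_sub_le hr (C := C') fun k hkr => ?_
    have h1 := (hk k hkr).2.2
    split_ifs with hk0
    · rw [abs_of_nonneg hk0, ← abs_neg] at h1
      refine le_trans (le_of_eq ?_) h1
      congr 1; ring
    · rw [abs_of_neg (not_le.mp hk0)] at h1
      refine le_trans (le_of_eq ?_) h1
      congr 1; ring
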